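/- **Notation.** Boxes are pairs (row, column), with rows numbered from north to south and columns from west to east. For $\pi\in S_N$ let $D(\pi)=\{(\pi(j),i): i<j,\ \pi(i)>\pi(j)\}$ be its Rothe diagram; let $NW(\pi)$ be the set of boxes weakly north-west of some box of $D(\pi)$; let $Ess(\pi)$ be the set of south-east corners of $D(\pi)$, i.e. of boxes $(i,j)\in D(\pi)$ with $(i+1,j),(i,j+1)\notin D(\pi)$; and let $L(\pi)$ be $NW(\pi)$ minus the connected component of $D(\pi)$ containing $(1,1)$ (which is empty if $(1,1)\notin D(\pi)$). A permutation is dominant if its diagram is the Young diagram of a partition placed in the north-west corner. Let $n\ge 0$ and let $\pi=1\pi'\in S_{n+1}$, where $\pi(1)=1$ and $\pi$ acts on $\{2,\dots,n+1\}$ as a dominant permutation $\pi'$ of $n$ letters. Put $N=n+1$. **The polytope $\Phi(\mathbb P(Y_\pi))$.** Let $\overline{X_\pi}\subset\mathbb C^{N\times N}$ be the Zariski closure of $B_-\pi B_+$ (invertible lower triangular matrices, times the permutation matrix with a $1$ at $(\pi(j),j)$ for all $j$, times invertible upper triangular matrices), let $Y_\pi$ be its projection to the entries in $L(\pi)$,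 and let $\mathbb P(Y_\pi)$ be the projectivization of $Y_\pi$. Let $x_1,\dots,x_N,y_1,\dots,y_N$ be the standard basis of $\mathbb R^N\times\mathbb R^N$. The entry $(i,j)$ has weight $x_i-y_j$ under the action $(A,B)\cdot M=AMB^{-1}$ of pairs of diagonal matrices. The moment polytope $\Phi(\mathbb P(Y_\pi))$ is the convex hull of the weights $x_i-y_j$ of the coordinates $(i,j)\in L(\pi)$ that do not vanish identically on $\mathbb P(Y_\pi)$. **The tree $T(\pi)$.** Let $R=NW(\pi)\setminus Ess(\pi)$. Its south-east boundary, traversed from the south-west to the north-east corner, consists of one north step for each row and one east step for each column that meets $R$. Label all the north steps, and those east steps whose column contains no box of $Ess(\pi)$, by $\alpha_1,\dots,\alpha_m$ in the order in which they are traversed; every other east step gets the label of the north step directly preceding it. Put a dot in each box $(i,j)\in R$ for which $j$ is larger than the number of boxes of $D(\pi)$ in row $i$, and then, in every column, drop the dots to the southernmost boxes of $R$ in that column. The tree $T(\pi)$ has vertices $\alpha_1,\dots,\alpha_m$ (ordered by index); each dropped dot gives an edge from the label of the east step of its column to the label of the north step of its row. **Root polytopes.** For a graph $G$ on $\alpha_1,\dots,\alpha_m$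 let $\mathcal P(G)\subset\mathbb R^m$ be the convex hull of $0$ and of all $e_i-e_j$, $i<j$, that lie in the cone generated by the vectors $e_a-e_b$ for the edges $(\alpha_a,\alpha_b)$ of $G$ with $a<b$. The top-dimensional simplices of the canonical triangulation of $\mathcal P(G)$ are the polytopes $\mathcal P(T')$, where $T'$ runs over the noncrossing alternating spanning trees of the directed transitive closure of $G$ (in which $\alpha_i,\alpha_j$, $i<j$, are joined iff $G$ has an increasing path from $\alpha_i$ to $\alpha_j$). Here noncrossing means that there are no edges $(\alpha_i,\alpha_k),(\alpha_j,\alpha_l)$ with $i<j<k<l$, and alternating means that there are no edges $(\alpha_i,\alpha_j),(\alpha_j,\alpha_k)$ with $i<j<k$. **The maps.** Let $K$ be the linear map with $K(x_i)=x_i$, with $K(y_j)=x_i$ if $(i,j)\in Ess(\pi)$, and with $K(y_j)=y_j$ if there is no such $i$. Let $L$ be the linear map with $L(x_i)=-e_k$, where $\alpha_k$ is the label of the north step of row $i$; with $L(y_j)=0$ if column $j$ contains a box of $Ess(\pi)$; and with $L(y_j)=-e_k$ otherwise, where $\alpha_k$ is the label of the east step of column $j$. (The values of $L$ on $x_i$,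 $y_j$ for rows and columns that do not meet $R$ are irrelevant on $\Phi(\mathbb P(Y_\pi))$; set them to $0$.) **Theorem.** Let $\pi=1\pi'$ with $\pi'$ dominant, and let $\Delta_1,\dots,\Delta_k$ be the distinct top-dimensional simplices of the canonical triangulation of $\mathcal P(T(\pi))$. Then the preimages $$P_i=\{z\in\Phi(\mathbb P(Y_\pi)) : L(K(z))\in\Delta_i\},\qquad i=1,\dots,k,$$ are pairwise distinct, and they are exactly the top-dimensional simplices (those of dimension $\dim\Phi(\mathbb P(Y_\pi))$) of a triangulation of $\Phi(\mathbb P(Y_\pi))$, that is, of a finite geometric simplicial complex whose underlying space is $\Phi(\mathbb P(Y_\pi))$ and whose vertices are vertices of $\Phi(\mathbb P(Y_\pi))$. This triangulation is called the canonical triangulation of $\Phi(\mathbb P(Y_\pi))$. (If $\pi$ is the identity, then $\Phi(\mathbb P(Y_\pi))$ is empty, $T(\pi)$ has no vertices, $k=0$, and the triangulation is empty.) -/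

import Mathlib

namespace SchubertRoot

/-! ### Permutations, diagrams and regions of boxes

Rows and columns are indexed by `Fin N`, i.e. from `0`; a box is a pair (row, column), rows are
numbered from north to south and columns from west to east. -/

/-- The Rothe diagram `{(π j, i) : i < j, π i > π j}`. -/
def rotheDiagram {N : ℕ} (π : Equiv.Perm (Fin N)) : Finset (Fin N × Fin N) :=
  Finset.univ.filter fun p => ∃ i j : Fin N, i < j ∧ π j < π i ∧ p = (π j, i)

/-- A permutation is dominant if its diagram is (the Young diagram of) a partition, placed in the
north-west corner. -/
def IsDominant {N : ℕ} (π : Equiv.Perm (Fin N)) : Prop :=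
  IsLowerSet (rotheDiagram π : Set (Fin N × Fin N))

/-- The permutation `1π'`: it fixes the first letter and acts as `π'` on the other letters. -/
def oneTimes {n : ℕ} (π' : Equiv.Perm (Fin n)) : Equiv.Perm (Fin (n + 1)) :=
  Equiv.Perm.decomposeFin.symm (0, π')

/-- The boxes weakly north-west of some box of the diagram. -/
def nwRegion {N : ℕ} (π : Equiv.Perm (Fin N)) : Finset (Fin N × Fin N) :=
  Finset.univ.filter fun p => ∃ q ∈ rotheDiagram π, p ≤ q

/-- Fulton's essential set: the south-east corners of the diagram, i.e. the boxes of the diagram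
for which neither the next box to the south nor the next box to the east is in the diagram. -/
def essentialSet {N : ℕ} (π : Equiv.Perm (Fin N)) : Finset (Fin N × Fin N) :=
  (rotheDiagram π).filter fun p =>
    (∀ i : Fin N, (i : ℕ) = p.1 + 1 → (i, p.2) ∉ rotheDiagram π) ∧
    (∀ j : Fin N, (j : ℕ) = p.2 + 1 → (p.1, j) ∉ rotheDiagram π)

/-- Two boxes are adjacent if they share an edge. -/
def BoxAdj {N : ℕ} (p q : Fin N × Fin N) : Prop :=
  (p.1 = q.1 ∧ ((p.2 : ℕ) + 1 = q.2 ∨ (q.2 : ℕ) + 1 = p.2)) ∨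
  (p.2 = q.2 ∧ ((p.1 : ℕ) + 1 = q.1 ∨ (q.1 : ℕ) + 1 = p.1))

/-- The dominant piece: the connected component of the diagram that contains the north-west most
box of the grid (empty if that box is not in the diagram). -/
def dominantPiece {N : ℕ} (π : Equiv.Perm (Fin N)) : Set (Fin N × Fin N) :=
  {p | ∃ c ∈ rotheDiagram π, (c.1 : ℕ) = 0 ∧ (c.2 : ℕ) = 0 ∧
    Relation.ReflTransGen (fun a b => b ∈ rotheDiagram π ∧ BoxAdj a b) c p}

/-- The region `L(π)`. -/
def regionL {N : ℕ} (π : Equiv.Perm (Fin N)) : Set (Fin N × Fin N) :=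
  (nwRegion π : Set (Fin N × Fin N)) \ dominantPiece π

/-! ### Matrix Schubert varieties and their moment polytopes -/

/-- The permutation matrix, with a `1` in position `(i, j)` iff `π j = i`. -/
def permMatrix {N : ℕ} (π : Equiv.Perm (Fin N)) : Matrix (Fin N) (Fin N) ℂ :=
  Matrix.of fun i j => if π j = i then 1 else 0

/-- The orbit `B₋ π B₊`. -/
def borelOrbit {N : ℕ} (π : Equiv.Perm (Fin N)) : Set (Matrix (Fin N) (Fin N) ℂ) :=
  {M | ∃ X Y : Matrix (Fin N) (Fin N) ℂ, IsUnit X ∧ IsUnit Y ∧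
    (∀ i j, i < j → X i j = 0) ∧ (∀ i j, j < i → Y i j = 0) ∧ M = X * permMatrix π * Y⁻¹}

/-- The matrix Schubert variety: the Zariski closure of `B₋ π B₊` in the space of matrices. -/
def matrixSchubert {N : ℕ} (π : Equiv.Perm (Fin N)) : Set (Matrix (Fin N) (Fin N) ℂ) :=
  {M | ∀ f : MvPolynomial (Fin N × Fin N) ℂ,
    (∀ M' ∈ borelOrbit π, MvPolynomial.eval (fun p => M' p.1 p.2) f = 0) →
      MvPolynomial.eval (fun p => M p.1 p.2) f = 0}

/-- `Y_π`: the projection of the matrix Schubert variety to the entries in `L(π)`. -/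
def varietyY {N : ℕ} (π : Equiv.Perm (Fin N)) : Set (regionL π → ℂ) :=
  (fun M p => M p.1.1 p.1.2) '' matrixSchubert π

/-- The projectivization of a cone. -/
def projectivize {ι : Type*} (Y : Set (ι → ℂ)) : Set (Projectivization ℂ (ι → ℂ)) :=
  {p | ∃ (z : ι → ℂ) (hz : z ≠ 0), z ∈ Y ∧ p = Projectivization.mk ℂ z hz}

/-- The moment polytope of an irreducible torus-stable subvariety `X` of a projective space whose
`i`-th homogeneous coordinate has weight `wt i`: the convex hull of the weights of the coordinates
of a general point of `X`, i.e. of those coordinates that do not vanish identically on `X`. -/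
def momentPolytope {ι E : Type*} [AddCommGroup E] [Module ℝ E] (wt : ι → E)
    (X : Set (Projectivization ℂ (ι → ℂ))) : Set E :=
  convexHull ℝ {w | ∃ i, (∃ p ∈ X, p.rep i ≠ 0) ∧ w = wt i}

/-- The weight `x_i - y_j` by which pairs `(A, B)` of diagonal matrices act on the `(i, j)` entry of
`A M B⁻¹`. The space `ℝ^N × ℝ^N` is `Fin N ⊕ Fin N → ℝ`; `x_i` and `y_j` are the basis vectors
belonging to `Sum.inl i` and `Sum.inr j`. -/
def boxWeight {N : ℕ} (p : Fin N × Fin N) : Fin N ⊕ Fin N → ℝ :=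
  Pi.single (Sum.inl p.1) 1 - Pi.single (Sum.inr p.2) 1

/-- The moment polytope `Φ(ℙ(Y_π))`. -/
def momentPolytopeY {N : ℕ} (π : Equiv.Perm (Fin N)) : Set (Fin N ⊕ Fin N → ℝ) :=
  momentPolytope (fun p : regionL π => boxWeight p.1) (projectivize (varietyY π))

/-! ### Acyclic root polytopes and their canonical triangulations

Graphs live on a finite linearly ordered vertex set; an edge is directed from its smaller to its
larger vertex. -/

/-- `e_i - e_j`. -/
def rootVec {V : Type*} [DecidableEq V] (i j : V) : V → ℝ :=
  Pi.single i 1 - Pi.single j 1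

/-- `cone(G)`, generated by the vectors `e_i - e_j` for the edges `i < j` of `G`. -/
def rootCone {V : Type*} [LinearOrder V] (G : SimpleGraph V) : PointedCone ℝ (V → ℝ) :=
  PointedCone.hull ℝ {v | ∃ i j, i < j ∧ G.Adj i j ∧ v = rootVec i j}

/-- The acyclic root polytope `P(G)`: the convex hull of `0` and of the positive roots that lie in
`cone(G)`. -/
def acyclicRootPolytope {V : Type*} [LinearOrder V] (G : SimpleGraph V) : Set (V → ℝ) :=
  convexHull ℝ (insert 0 {v | ∃ i j, i < j ∧ v = rootVec i j ∧ v ∈ rootCone G})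

/-- The directed transitive closure of `G`: `i < j` are joined iff there is an increasing path in
`G` from `i` to `j`. -/
def dirTransClosure {V : Type*} [LinearOrder V] (G : SimpleGraph V) : SimpleGraph V :=
  SimpleGraph.fromRel (Relation.TransGen fun i j => i < j ∧ G.Adj i j)

/-- No two edges cross when the vertices are drawn in order on a line, the edges above it. -/
def IsNoncrossing {V : Type*} [LinearOrder V] (G : SimpleGraph V) : Prop :=
  ∀ i j k l, i < j → j < k → k < l → ¬ (G.Adj i k ∧ G.Adj j l)

/-- No vertex has both an incoming and an outgoing edge. -/
def IsAlternating {V : Type*} [LinearOrder V] (G : SimpleGraph V) : Prop :=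
  ∀ i j k, i < j → j < k → ¬ (G.Adj i j ∧ G.Adj j k)

/-- The top-dimensional simplices of the canonical triangulation of `P(G)`: the polytopes `P(T)`
for the noncrossing alternating spanning trees `T` of the directed transitive closure of `G`. -/
def canonicalTopSimplices {V : Type*} [LinearOrder V] (G : SimpleGraph V) : Set (Set (V → ℝ)) :=
  {Δ | ∃ T : SimpleGraph V, T ≤ dirTransClosure G ∧ T.IsTree ∧ IsNoncrossing T ∧
    IsAlternating T ∧ Δ = acyclicRootPolytope T}

/-! ### The tree `T(π)`, for `π = 1π'` with `π'` dominant -/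

/-- The region `R(π) = NW(π) - Ess(π)`. -/
def regionR {N : ℕ} (π : Equiv.Perm (Fin N)) : Finset (Fin N × Fin N) :=
  nwRegion π \ essentialSet π

/-- Number of boxes of `S` in row `i`. -/
def rowCount {N : ℕ} (S : Finset (Fin N × Fin N)) (i : Fin N) : ℕ :=
  (S.filter fun p => p.1 = i).card

/-- Number of boxes of `S` in column `j`. -/
def colCount {N : ℕ} (S : Finset (Fin N × Fin N)) (j : Fin N) : ℕ :=
  (S.filter fun p => p.2 = j).card

/-- The south-east boundary of the region `R(π)`, traversed from its south-west to its north-east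
corner, consists of one north step for every row (written `Sum.inl i`) and of one east step for
every column (written `Sum.inr j`). This is the position of a step along the boundary, up to an
additive constant. If `R(π)` has `r` rows, the north step of row `i` comes after `rowCount i` east
and `r - 1 - i` north steps, and the east step of column `j` comes after `j` east and
`r - colCount j` north steps; the common summand `r` is left out. -/
def stepPos {N : ℕ} (π : Equiv.Perm (Fin N)) : Fin N ⊕ Fin N → ℤ
  | Sum.inl i => (rowCount (regionR π) i : ℤ) - i - 1
  | Sum.inr j => (j : ℤ) - colCount (regionR π) j

/-- The set `A` of labelled steps: all north steps, and the east steps that do not bound a box of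
the essential set. -/
def labelledSteps {N : ℕ} (π : Equiv.Perm (Fin N)) : Finset (Fin N ⊕ Fin N) :=
  (Finset.univ.filter fun i => ∃ j, (i, j) ∈ regionR π).disjSum
    (Finset.univ.filter fun j =>
      (∃ i, (i, j) ∈ regionR π) ∧ ¬ ∃ i, (i, j) ∈ essentialSet π)

/-- The vertices `α_1, ..., α_m` of `T(π)`: the steps in `A`, in the order in which they are
traversed. -/
def TVertex {N : ℕ} (π : Equiv.Perm (Fin N)) : Type :=
  {s : Fin N ⊕ Fin N // s ∈ labelledSteps π}

instance {N : ℕ} (π : Equiv.Perm (Fin N)) : Fintype (TVertex π) :=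
  inferInstanceAs (Fintype {s : Fin N ⊕ Fin N // s ∈ labelledSteps π})

/-- Vertices are compared by their position along the boundary. (Distinct steps of a boundary have
distinct positions; the second entry of the key only makes this a linear order for all `π`.) -/
instance {N : ℕ} (π : Equiv.Perm (Fin N)) : LinearOrder (TVertex π) :=
  LinearOrder.lift' (fun v => (toLex (stepPos π v.1, toLex v.1) : ℤ ×ₗ (Fin N ⊕ₗ Fin N)))
    (fun v w h => by
      have h2 := congrArg (fun z => ofLex (ofLex z).2) h
      exact Subtype.ext h2)

/-- `v` is the label of the step `s`. A step in `A` is its own label; a step that is not in `A` has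
the label of the north step directly preceding it. -/
def HasLabel {N : ℕ} (π : Equiv.Perm (Fin N)) (s : Fin N ⊕ Fin N) (v : TVertex π) : Prop :=
  v.1 = s ∨ (s ∉ labelledSteps π ∧ ∃ i : Fin N, v.1 = Sum.inl i ∧
    stepPos π (Sum.inl i) + 1 = stepPos π s)

/-- The dots in `R(π)`, before they are dropped: the elbows in `R(π)` of the bottom reduced pipe
dream. This pipe dream has its crosses at the boxes of the diagram after these have been aligned to
the left. -/
def dots {N : ℕ} (π : Equiv.Perm (Fin N)) : Finset (Fin N × Fin N) :=
  (regionR π).filter fun p => rowCount (rotheDiagram π) p.1 ≤ p.2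

/-- The dots dropped to the south: a box of `R(π)` receives a dot iff the number of boxes of `R(π)`
below it in its column is less than the number of dots in that column. -/
def droppedDots {N : ℕ} (π : Equiv.Perm (Fin N)) : Finset (Fin N × Fin N) :=
  (regionR π).filter fun p =>
    ((regionR π).filter fun q => q.2 = p.2 ∧ p.1 < q.1).card < colCount (dots π) p.2

/-- The tree `T(π)`: every dropped dot gives an edge from the label of the east step of its column
to the label of the north step of its row. -/
def treeT {N : ℕ} (π : Equiv.Perm (Fin N)) : SimpleGraph (TVertex π) :=
  SimpleGraph.fromRel fun u v =>
    ∃ p ∈ droppedDots π, HasLabel π (Sum.inr p.2) u ∧ HasLabel π (Sum.inl p.1) v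

/-! ### The linear maps `K` and `L` -/

/-- `K(x_i) = x_i`; `K(y_j) = x_i` if `(i, j)` is in the essential set (there is at most one such
`i`), and `K(y_j) = y_j` if there is no such `i`. -/
noncomputable def mapK {N : ℕ} (π : Equiv.Perm (Fin N)) :
    (Fin N ⊕ Fin N → ℝ) →ₗ[ℝ] (Fin N ⊕ Fin N → ℝ) :=
  Fintype.linearCombination ℝ fun s => match s with
    | Sum.inl i => Pi.single (Sum.inl i) 1
    | Sum.inr j =>
      if h : ∃ i, (i, j) ∈ essentialSet π then Pi.single (Sum.inl h.choose) 1
      else Pi.single (Sum.inr j) 1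

/-- The basis vector `e_k`, for a step with label `α_k` in `A` (and `0` for the other steps). -/
def stepVec {N : ℕ} (π : Equiv.Perm (Fin N)) (s : Fin N ⊕ Fin N) : TVertex π → ℝ :=
  if h : s ∈ labelledSteps π then Pi.single ⟨s, h⟩ 1 else 0

/-- `L(x_i) = -e_k`, where `α_k` is the label of the north step of row `i`; `L(y_j) = 0` if column
`j` has a box of the essential set, and otherwise `L(y_j) = -e_k`, where `α_k` is the label of the
east step of column `j`. (Rows and columns that do not meet the region are sent to `0`; they play no
role on the moment polytope.) -/
noncomputable def mapL {N : ℕ} (π : Equiv.Perm (Fin N)) :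
    (Fin N ⊕ Fin N → ℝ) →ₗ[ℝ] (TVertex π → ℝ) :=
  Fintype.linearCombination ℝ fun s => match s with
    | Sum.inl i => -stepVec π (Sum.inl i)
    | Sum.inr j => if ∃ i, (i, j) ∈ essentialSet π then 0 else -stepVec π (Sum.inr j)

/-- The preimage of `Δ` under `L ∘ K`, as a map defined on `Φ(ℙ(Y_π))`. -/
def preimageLK {N : ℕ} (π : Equiv.Perm (Fin N)) (Δ : Set (TVertex π → ℝ)) :
    Set (Fin N ⊕ Fin N → ℝ) :=
  {z | z ∈ momentPolytopeY π ∧ mapL π (mapK π z) ∈ Δ}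

/-! ### Triangulations of polytopes -/

/-- A triangulation of a polytope `P`: a finite geometric simplicial complex with underlying space
`P`, all of whose vertices are vertices of `P`. -/
def IsTriangulation {E : Type*} [AddCommGroup E] [Module ℝ E]
    (C : Geometry.SimplicialComplex ℝ E) (P : Set E) : Prop :=
  C.faces.Finite ∧ C.space = P ∧ C.vertices ⊆ P.extremePoints ℝ

/-- The simplices of `C` (as sets) that have the same dimension as `P`. -/
def topSimplices {E : Type*} [AddCommGroup E] [Module ℝ E]
    (C : Geometry.SimplicialComplex ℝ E) (P : Set E) : Set (Set E) :=
  {S | ∃ s ∈ C.faces, s.card = Module.finrank ℝ (vectorSpan ℝ P) + 1 ∧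
    S = convexHull ℝ (s : Set E)}

end SchubertRoot

open SchubertRoot

/-! For `π = 1π'` with `π'` dominant, the diagram is a Young diagram moved one step to the
south-east. Hence `NW(π)` is itself a Young diagram `μ`, whose corners are the essential boxes. The
dominant piece is empty and no entry vanishes identically on the orbit, so the moment polytope is
the convex hull of the weights `x_i - y_j` with `(i, j) ∈ μ` (`momentPolytopeY_eq`).

This polytope has a triangulation governed by the exchange relation `w(i,j) + w(i',j') = w(i,j') +
w(i',j)`. Call a set of boxes noncrossing if it contains no `(i,j)`, `(i',j')` with `i' < i`, `j <
j'` and `(i,j') ∈ μ`. Every point has a convex expansion with noncrossing support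
(`exists_noncrossing_coeff`), and that expansion is unique (`IsNoncrossingIn.coeff_unique`), even if
coefficients at the corners of `μ` are allowed to be negative.

Label rows by `a` and columns by `b` as in `T(π)`. Then, for rows and columns meeting `μ`, `(i,j) ∈
μ` iff `b j ≤ a i`, with equality exactly at the corners (`isLabelling_stepLabel`). The map `L ∘ K`
sends the weight of `(i,j)` to `e_{b j} - e_{a i}`, hence kills the corners, and the directed
transitive closure of `T(π)` has one edge for each box of `μ` that is not a corner
(`dirTransClosure_treeT_adj_iff`). Under this dictionary the noncrossing alternating spanning trees
are the noncrossing sets of full dimension: such a set consists of all corners and of one box per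
edge of the tree.

The preimage of `P(T)` is the corresponding simplex (`preimage_acyclicRootPolytope`): lying over
`cone(T)` makes the coefficients at tree edges nonnegative, and the strong form of uniqueness takes
care of the corners, which `L ∘ K` does not see. -/

namespace SchubertRoot

/-! ### Convex hulls and spans of finite families -/

section Families

variable {ι E : Type*} [Fintype ι] [AddCommGroup E] [Module ℝ E]

/-- Coefficients are functions on all of `ι`, so that expansions supported on different sets can be
compared. -/
theorem mem_convexHull_image_iff (v : ι → E) (S : Finset ι) (z : E) :
    z ∈ convexHull ℝ (v '' S) ↔ ∃ c : ι → ℝ, (∀ p, 0 ≤ c p) ∧ (∀ p, c p ≠ 0 → p ∈ S) ∧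
      ∑ p, c p = 1 ∧ ∑ p, c p • v p = z := by
  classical
  constructor
  · intro hz
    have hconv : Convex ℝ {z : E | ∃ c : ι → ℝ, (∀ p, 0 ≤ c p) ∧ (∀ p, c p ≠ 0 → p ∈ S) ∧
        ∑ p, c p = 1 ∧ ∑ p, c p • v p = z} := by
      rintro x ⟨c, hc, hcS, hc1, rfl⟩ y ⟨d, hd, hdS, hd1, rfl⟩ s t hs ht hst
      refine ⟨fun p => s * c p + t * d p, fun p => ?_, fun p hp => ?_, ?_, ?_⟩
      · have := hc p
        have := hd p
        positivity
      · by_contra hpS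
        have h1 : c p = 0 := by_contra fun h => hpS (hcS p h)
        have h2 : d p = 0 := by_contra fun h => hpS (hdS p h)
        simp [h1, h2] at hp
      · rw [Finset.sum_add_distrib, ← Finset.mul_sum, ← Finset.mul_sum, hc1, hd1]
        linarith
      · simp only [add_smul, mul_smul, Finset.sum_add_distrib, ← Finset.smul_sum]
    refine convexHull_min ?_ hconv hz
    rintro _ ⟨p, hp, rfl⟩
    refine ⟨Pi.single p 1, fun q => ?_, fun q hq => ?_, by simp, ?_⟩
    · by_cases h : q = p
      · subst h; simp
      · simp [h]
    · by_cases h : q = p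
      · subst h; exact hp
      · simp [h] at hq
    · simp [Pi.single_apply, ite_smul]
  · rintro ⟨c, hc, hcS, hc1, rfl⟩
    have h1 : ∑ p ∈ S, c p = 1 := by
      rw [← hc1]
      exact Finset.sum_subset (Finset.subset_univ S) fun p _ hp => by_contra fun h => hp (hcS p h)
    have h2 : ∑ p, c p • v p = ∑ p ∈ S, c p • v p := by
      symm
      refine Finset.sum_subset (Finset.subset_univ S) fun p _ hp => ?_
      rw [by_contra fun h => hp (hcS p h), zero_smul]
    rw [h2]
    exact (convex_convexHull ℝ _).sum_mem (fun p _ => hc p) h1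
      fun p hp => subset_convexHull ℝ _ ⟨p, hp, rfl⟩

theorem mem_span_image_iff (v : ι → E) (S : Finset ι) (z : E) :
    z ∈ Submodule.span ℝ (v '' S) ↔ ∃ c : ι → ℝ, (∀ p, c p ≠ 0 → p ∈ S) ∧
      ∑ p, c p • v p = z := by
  classical
  constructor
  · intro hz
    induction hz using Submodule.span_induction with
    | mem x hx =>
      obtain ⟨p, hp, rfl⟩ := hx
      refine ⟨Pi.single p 1, fun q hq => ?_, by simp [Pi.single_apply, ite_smul]⟩
      by_cases h : q = p
      · subst h; exact hp
      · simp [h] at hq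
    | zero => exact ⟨0, by simp, by simp⟩
    | add x y _ _ hx hy =>
      obtain ⟨c, hc, rfl⟩ := hx
      obtain ⟨d, hd, rfl⟩ := hy
      refine ⟨c + d, fun p hp => ?_, by simp [add_smul, Finset.sum_add_distrib]⟩
      by_contra hpS
      have h1 : c p = 0 := by_contra fun h => hpS (hc p h)
      have h2 : d p = 0 := by_contra fun h => hpS (hd p h)
      simp [h1, h2] at hp
    | smul a x _ hx =>
      obtain ⟨c, hc, rfl⟩ := hx
      refine ⟨a • c, fun p hp => hc p fun h => hp (by simp [h]), ?_⟩
      simp [mul_smul, Finset.smul_sum]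
  · rintro ⟨c, hc, rfl⟩
    refine Submodule.sum_mem _ fun p _ => ?_
    by_cases h : c p = 0
    · simp [h]
    · exact Submodule.smul_mem _ _ (Submodule.subset_span ⟨p, hc p h, rfl⟩)

end Families

/-- The set `X` lies on a hyperplane missing the origin, so its span is the direct sum of its
direction space and one line. This turns affine dimension into linear rank. -/
theorem finrank_vectorSpan_add_one {E : Type*} [AddCommGroup E] [Module ℝ E]
    [FiniteDimensional ℝ E] {X : Set E} (hX : X.Nonempty) (f : E →ₗ[ℝ] ℝ)
    (hf : ∀ x ∈ X, f x = 1) :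
    Module.finrank ℝ (vectorSpan ℝ X) + 1 = Module.finrank ℝ (Submodule.span ℝ X) := by
  obtain ⟨x₀, hx₀⟩ := hX
  have hker : ∀ v ∈ vectorSpan ℝ X, f v = 0 := by
    intro v hv
    rw [vectorSpan_def] at hv
    induction hv using Submodule.span_induction with
    | mem x hx =>
      obtain ⟨a, ha, b, hb, rfl⟩ := hx
      simp [hf a ha, hf b hb]
    | zero => simp
    | add x y _ _ hx hy => simp [hx, hy]
    | smul a x _ hx => simp [hx]
  have hx0 : x₀ ≠ 0 := by
    rintro rfl
    simpa using hf 0 hx₀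
  have hsup : vectorSpan ℝ X ⊔ Submodule.span ℝ {x₀} = Submodule.span ℝ X := by
    apply le_antisymm
    · refine sup_le ?_ (Submodule.span_mono (by simpa using hx₀))
      rw [vectorSpan_def, Submodule.span_le]
      rintro _ ⟨a, ha, b, hb, rfl⟩
      exact Submodule.sub_mem _ (Submodule.subset_span ha) (Submodule.subset_span hb)
    · rw [Submodule.span_le]
      intro x hx
      have : x = (x -ᵥ x₀) + x₀ := by simp
      rw [this]
      exact Submodule.add_mem_sup (vsub_mem_vectorSpan ℝ hx hx₀) (Submodule.mem_span_singleton_self _)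
  have hinf : vectorSpan ℝ X ⊓ Submodule.span ℝ {x₀} = ⊥ := by
    rw [eq_bot_iff]
    rintro v ⟨hv, hv'⟩
    obtain ⟨a, rfl⟩ := Submodule.mem_span_singleton.1 hv'
    have := hker _ hv
    rw [map_smul, hf x₀ hx₀] at this
    simp at this
    simp [this]
  have := Submodule.finrank_sup_add_finrank_inf_eq (vectorSpan ℝ X) (Submodule.span ℝ {x₀})
  rw [hsup, hinf, finrank_bot, finrank_span_singleton hx0] at this
  omega

/-! ### Box weights -/

section BoxWeights

variable {N : ℕ}

theorem boxWeight_inl (p : Fin N × Fin N) (i : Fin N) :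
    boxWeight p (Sum.inl i) = if p.1 = i then 1 else 0 := by
  simp [boxWeight, Pi.single_apply, eq_comm]

theorem boxWeight_inr (p : Fin N × Fin N) (j : Fin N) :
    boxWeight p (Sum.inr j) = if p.2 = j then -1 else 0 := by
  by_cases h : p.2 = j
  · subst h; simp [boxWeight]
  · have h' : ¬ j = p.2 := fun e => h e.symm
    simp [boxWeight, h, h']

theorem boxWeight_injective : Function.Injective (boxWeight (N := N)) := by
  intro p q h
  have h1 := congrFun h (Sum.inl p.1)
  have h2 := congrFun h (Sum.inr p.2)
  rw [boxWeight_inl, boxWeight_inl] at h1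
  rw [boxWeight_inr, boxWeight_inr] at h2
  have e1 : q.1 = p.1 := by
    by_contra hne
    simp [hne] at h1
  have e2 : q.2 = p.2 := by
    by_contra hne
    simp [hne] at h2
  exact Prod.ext e1.symm e2.symm

/-- The sum of the `x`-coordinates, which is `1` on every box weight. -/
noncomputable def sumX (N : ℕ) : (Fin N ⊕ Fin N → ℝ) →ₗ[ℝ] ℝ :=
  ∑ i : Fin N, LinearMap.proj (Sum.inl i)

theorem sumX_boxWeight (p : Fin N × Fin N) : sumX N (boxWeight p) = 1 := by
  simp [sumX, LinearMap.sum_apply, boxWeight_inl]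

theorem sum_smul_boxWeight_inl (c : Fin N × Fin N → ℝ) (i : Fin N) :
    (∑ p, c p • boxWeight p) (Sum.inl i) = ∑ j, c (i, j) := by
  rw [Finset.sum_apply, Fintype.sum_prod_type, Finset.sum_eq_single i]
  · simp [boxWeight_inl]
  · intro k _ hk
    simp [boxWeight_inl, hk]
  · simp

theorem sum_smul_boxWeight_inr (c : Fin N × Fin N → ℝ) (j : Fin N) :
    (∑ p, c p • boxWeight p) (Sum.inr j) = -∑ i, c (i, j) := by
  rw [Finset.sum_apply, Fintype.sum_prod_type, ← Finset.sum_neg_distrib]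
  refine Finset.sum_congr rfl fun i _ => ?_
  rw [Finset.sum_eq_single j]
  · simp [boxWeight_inr]
  · intro k _ hk
    simp [boxWeight_inr, hk]
  · simp

/-- The functional `z ↦ z(x_i) - z(y_j)` for `p = (i, j)` equals `2` at the weight of `p` and is at
most `1` at all other box weights, so it exposes this vertex. -/
theorem boxWeight_mem_extremePoints {μ : Set (Fin N × Fin N)} {p : Fin N × Fin N} (hp : p ∈ μ) :
    boxWeight p ∈ (convexHull ℝ (boxWeight '' μ)).extremePoints ℝ := by
  classical
  have hsub : convexHull ℝ (boxWeight '' μ) ⊆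
      convexHull ℝ (boxWeight '' ((Finset.univ : Finset (Fin N × Fin N)) : Set _)) :=
    convexHull_mono (Set.image_mono (by simp))
  have hp1 : ∀ z ∈ convexHull ℝ (boxWeight '' μ), z (Sum.inl p.1) - z (Sum.inr p.2) ≤ 2 ∧
      (z (Sum.inl p.1) - z (Sum.inr p.2) = 2 → z = boxWeight p) := by
    intro z hz
    obtain ⟨c, hc, -, hc1, rfl⟩ := (mem_convexHull_image_iff _ _ _).1 (hsub hz)
    have hval : ∀ q : Fin N × Fin N, boxWeight q (Sum.inl p.1) - boxWeight q (Sum.inr p.2) ≤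
        (if q = p then 2 else 1) := by
      intro q
      rw [boxWeight_inl, boxWeight_inr]
      by_cases h1 : q.1 = p.1 <;> by_cases h2 : q.2 = p.2
      · simp [h1, h2, Prod.ext_iff]; norm_num
      all_goals simp [h1, h2, Prod.ext_iff]
    have hsum : (∑ q, c q • boxWeight q) (Sum.inl p.1) - (∑ q, c q • boxWeight q) (Sum.inr p.2) ≤
        1 + c p := by
      rw [Finset.sum_apply, Finset.sum_apply, ← Finset.sum_sub_distrib]
      calc _ ≤ ∑ q, c q * (if q = p then 2 else 1) := by
            refine Finset.sum_le_sum fun q _ => ?_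
            simp only [Pi.smul_apply, smul_eq_mul, ← mul_sub]
            exact mul_le_mul_of_nonneg_left (hval q) (hc q)
        _ = ∑ q, (c q + if q = p then c q else 0) := by
            refine Finset.sum_congr rfl fun q _ => ?_
            split_ifs <;> ring
        _ = 1 + c p := by rw [Finset.sum_add_distrib, hc1]; simp
    have hcp : c p ≤ 1 := hc1 ▸ Finset.single_le_sum (fun q _ => hc q) (Finset.mem_univ p)
    refine ⟨by linarith, fun h => ?_⟩
    have hcp1 : c p = 1 := by linarith
    have hrest : ∀ q, q ≠ p → c q = 0 := by
      intro q hq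
      have := Finset.sum_le_univ_sum_of_nonneg (s := {p, q}) hc
      rw [Finset.sum_pair hq.symm, hc1] at this
      have := hc q
      linarith
    rw [Finset.sum_eq_single p (fun q _ hq => by rw [hrest q hq, zero_smul]) (by simp), hcp1,
      one_smul]
  have hwp : boxWeight p (Sum.inl p.1) - boxWeight p (Sum.inr p.2) = 2 := by
    rw [boxWeight_inl, boxWeight_inr]
    norm_num
  rw [mem_extremePoints]
  refine ⟨subset_convexHull ℝ _ ⟨p, hp, rfl⟩, ?_⟩
  rintro x hx y hy ⟨s, t, hs, ht, hst, hxy⟩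
  obtain ⟨hx1, hx2⟩ := hp1 x hx
  obtain ⟨hy1, hy2⟩ := hp1 y hy
  have e1 := congrFun hxy (Sum.inl p.1)
  have e2 := congrFun hxy (Sum.inr p.2)
  simp only [Pi.add_apply, Pi.smul_apply, smul_eq_mul] at e1 e2
  have key : s * (2 - (x (Sum.inl p.1) - x (Sum.inr p.2))) +
      t * (2 - (y (Sum.inl p.1) - y (Sum.inr p.2))) = 0 := by
    have : t = 1 - s := by linarith
    subst this
    linarith
  have k1 : 0 ≤ s * (2 - (x (Sum.inl p.1) - x (Sum.inr p.2))) :=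
    mul_nonneg hs.le (by linarith)
  have k2 : 0 ≤ t * (2 - (y (Sum.inl p.1) - y (Sum.inr p.2))) :=
    mul_nonneg ht.le (by linarith)
  have k3 : s * (2 - (x (Sum.inl p.1) - x (Sum.inr p.2))) = 0 := by linarith
  have k4 : t * (2 - (y (Sum.inl p.1) - y (Sum.inr p.2))) = 0 := by linarith
  constructor
  · exact hx2 (by rcases mul_eq_zero.1 k3 with h | h <;> linarith)
  · exact hy2 (by rcases mul_eq_zero.1 k4 with h | h <;> linarith)

end BoxWeights

/-! ### Noncrossing sets of boxes -/

section Noncrossing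

variable {N : ℕ}

/-- The arcs of the boxes in `S` do not cross when every box of the shape `μ` is drawn as an arc
between the boundary steps of its column and of its row. -/
def IsNoncrossingIn (μ S : Set (Fin N × Fin N)) : Prop :=
  ∀ i j i' j', (i, j) ∈ S → (i', j') ∈ S → i' < i → j < j' → (i, j') ∉ μ

theorem IsNoncrossingIn.mono {μ S T : Set (Fin N × Fin N)} (h : IsNoncrossingIn μ S)
    (hTS : T ⊆ S) : IsNoncrossingIn μ T :=
  fun i j i' j' h1 h2 => h i j i' j' (hTS h1) (hTS h2)

/-- If `c' p > c p`, equality of row and column sums forces boxes in the row and in the column of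
`p` where `c > c'`. By `hmax` they lie to the west and to the north of `p`, where `c' ≥ 0`, so both
are in the support of `c`. They cross, because `p ∈ μ` is the south-east corner of their rectangle.
-/
theorem IsNoncrossingIn.coeff_le_of_maximal {μ : Finset (Fin N × Fin N)}
    {c c' : Fin N × Fin N → ℝ}
    (hc : IsNoncrossingIn (μ : Set (Fin N × Fin N)) {p | c p ≠ 0})
    (hpos' : ∀ p q, q ∈ μ → p < q → 0 ≤ c' p)
    (heq : ∑ p, c p • boxWeight p = ∑ p, c' p • boxWeight p) {p : Fin N × Fin N}
    (hmax : ∀ q, p < q → c q = c' q) (hp : p ∈ μ) : c' p ≤ c p := by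
  by_contra hlt
  push Not at hlt
  obtain ⟨i, j⟩ := p
  have hrow := congrFun heq (Sum.inl i)
  have hcol := congrFun heq (Sum.inr j)
  rw [sum_smul_boxWeight_inl, sum_smul_boxWeight_inl] at hrow
  rw [sum_smul_boxWeight_inr, sum_smul_boxWeight_inr, neg_inj] at hcol
  have h1 : ∃ j₀, c' (i, j₀) < c (i, j₀) := by
    by_contra! h
    exact absurd hrow (Finset.sum_lt_sum (fun k _ => h k) ⟨j, Finset.mem_univ _, hlt⟩).ne
  have h2 : ∃ i₀, c' (i₀, j) < c (i₀, j) := by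
    by_contra! h
    exact absurd hcol (Finset.sum_lt_sum (fun k _ => h k) ⟨i, Finset.mem_univ _, hlt⟩).ne
  obtain ⟨j₀, hj₀⟩ := h1
  obtain ⟨i₀, hi₀⟩ := h2
  have hj : j₀ < j := by
    rcases lt_trichotomy j₀ j with h | h | h
    · exact h
    · subst h; exact absurd hj₀ hlt.not_gt
    · exact absurd hj₀ (hmax (i, j₀) (Prod.mk_lt_mk_iff_right.2 h)).not_gt
  have hi : i₀ < i := by
    rcases lt_trichotomy i₀ i with h | h | h
    · exact h
    · subst h; exact absurd hi₀ hlt.not_gt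
    · exact absurd hi₀ (hmax (i₀, j) (Prod.mk_lt_mk_iff_left.2 h)).not_gt
  have hj' := hpos' (i, j₀) (i, j) hp (Prod.mk_lt_mk_iff_right.2 hj)
  have hi' := hpos' (i₀, j) (i, j) hp (Prod.mk_lt_mk_iff_left.2 hi)
  exact hc i j₀ i₀ j (hj'.trans_lt hj₀).ne' (hi'.trans_lt hi₀).ne' hi hj hp

/-- Combinations of box weights with noncrossing support are determined by their value. The
coefficients at maximal boxes of the shape may be negative. -/
theorem IsNoncrossingIn.coeff_unique {μ : Finset (Fin N × Fin N)} {c c' : Fin N × Fin N → ℝ}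
    (hc : IsNoncrossingIn (μ : Set (Fin N × Fin N)) {p | c p ≠ 0})
    (hc' : IsNoncrossingIn (μ : Set (Fin N × Fin N)) {p | c' p ≠ 0})
    (hcμ : ∀ p, c p ≠ 0 → p ∈ μ) (hcμ' : ∀ p, c' p ≠ 0 → p ∈ μ)
    (hpos : ∀ p q, q ∈ μ → p < q → 0 ≤ c p) (hpos' : ∀ p q, q ∈ μ → p < q → 0 ≤ c' p)
    (heq : ∑ p, c p • boxWeight p = ∑ p, c' p • boxWeight p) : c = c' := by
  by_contra hne
  obtain ⟨p₀, hp₀⟩ := Function.ne_iff.1 hne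
  obtain ⟨p, hp, hmax⟩ := (Set.toFinite {p | c p ≠ c' p}).exists_maximal ⟨p₀, hp₀⟩
  have hmax' : ∀ q, p < q → c q = c' q := by
    intro q hq
    by_contra hcq
    exact hq.not_ge (hmax hcq hq.le)
  have hpμ : p ∈ μ := by
    by_contra h
    have h1 : c p = 0 := by_contra fun h' => h (hcμ p h')
    have h2 : c' p = 0 := by_contra fun h' => h (hcμ' p h')
    exact hp (h1.trans h2.symm)
  exact hp (le_antisymm
    (hc'.coeff_le_of_maximal hpos heq.symm (fun q hq => (hmax' q hq).symm) hpμ)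
    (hc.coeff_le_of_maximal hpos' heq hmax' hpμ))

/-- The positive and negative parts of a linear relation are two nonnegative expansions of the same
vector with support in `S`. By uniqueness they agree, so the relation is trivial. -/
theorem IsNoncrossingIn.linearIndepOn {μ S : Finset (Fin N × Fin N)}
    (hS : IsNoncrossingIn (μ : Set (Fin N × Fin N)) S) (hSμ : S ⊆ μ) :
    LinearIndepOn ℝ boxWeight (S : Set (Fin N × Fin N)) := by
  classical
  rw [linearIndepOn_finset_iff]
  intro f hf
  set g : Fin N × Fin N → ℝ := fun p => if p ∈ S then f p else 0 with hg
  have hgS : ∀ p, g p ≠ 0 → p ∈ S := fun p hp => by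
    by_contra h
    simp [hg, h] at hp
  have hsum : ∑ p, g p • boxWeight p = 0 := by
    rw [← hf]
    simp [hg, ite_smul]
  have hpS : ∀ p, (g p)⁺ ≠ 0 → p ∈ S := fun p hp => hgS p fun h => hp (by simp [h])
  have hnS : ∀ p, (g p)⁻ ≠ 0 → p ∈ S := fun p hp => hgS p fun h => hp (by simp [h])
  have key : (fun p => (g p)⁺) = fun p => (g p)⁻ := by
    refine IsNoncrossingIn.coeff_unique (μ := μ) (hS.mono hpS) (hS.mono hnS)
      (fun p hp => hSμ (hpS p hp)) (fun p hp => hSμ (hnS p hp))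
      (fun p _ _ _ => posPart_nonneg _) (fun p _ _ _ => negPart_nonneg _) ?_
    rw [← sub_eq_zero, ← Finset.sum_sub_distrib, ← hsum]
    refine Finset.sum_congr rfl fun p _ => ?_
    rw [← sub_smul, posPart_sub_negPart]
  intro p hp
  have h1 := congrFun key p
  have h2 := posPart_sub_negPart (g p)
  rw [h1, sub_self] at h2
  simpa [hg, hp] using h2.symm

/-- Every point of the polytope of a shape lies in a simplex of noncrossing boxes. -/
theorem exists_noncrossing_coeff {μ : Finset (Fin N × Fin N)}
    (hμ : IsLowerSet (μ : Set (Fin N × Fin N))) {z : Fin N ⊕ Fin N → ℝ}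
    (hz : z ∈ convexHull ℝ (boxWeight '' (μ : Set (Fin N × Fin N)))) :
    ∃ c : Fin N × Fin N → ℝ, (∀ p, 0 ≤ c p) ∧ (∀ p, c p ≠ 0 → p ∈ μ) ∧ ∑ p, c p = 1 ∧
      ∑ p, c p • boxWeight p = z ∧
      IsNoncrossingIn (μ : Set (Fin N × Fin N)) {p | c p ≠ 0} := by
  classical
  set F : Set (Fin N × Fin N → ℝ) :=
    stdSimplex ℝ (Fin N × Fin N) ∩ ({c | ∑ p, c p • boxWeight p = z} ∩ {c | ∀ p, p ∉ μ → c p = 0})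
    with hF
  have hFc : IsCompact F := by
    refine (isCompact_stdSimplex ℝ _).inter_right (IsClosed.inter ?_ ?_)
    · exact isClosed_eq (by fun_prop) continuous_const
    · simp only [Set.ofPred_forall]
      exact isClosed_iInter fun p => isClosed_iInter fun _ =>
        isClosed_eq (continuous_apply p) continuous_const
  have hFn : F.Nonempty := by
    obtain ⟨c, h0, h1, h2, h3⟩ := (mem_convexHull_image_iff _ _ _).1 hz
    exact ⟨c, ⟨h0, h2⟩, h3, fun p hp => by_contra fun h => hp (h1 p h)⟩
  -- Replacing a crossing pair `(i,j)`, `(i',j')` by `(i,j')`, `(i',j)` preserves the point and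
  -- raises this functional by `(i - i')(j' - j)` per unit moved. A maximizer on the compact set of
  -- expansions therefore has no crossing.
  set f : (Fin N × Fin N → ℝ) → ℝ := fun c => ∑ p, c p * ((p.1 : ℝ) * (p.2 : ℝ)) with hf
  obtain ⟨c, hcF, hmax⟩ := hFc.exists_isMaxOn hFn
    (f := f) (Continuous.continuousOn (by simp only [hf]; fun_prop))
  obtain ⟨⟨h0, h1⟩, h2, h3⟩ := hcF
  refine ⟨c, h0, fun p hp => by_contra fun h => hp (h3 p h), h1, h2, ?_⟩
  intro i j i' j' hij hij' hi hj hμij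
  have hcij : 0 < c (i, j) := lt_of_le_of_ne (h0 _) (Ne.symm hij)
  have hcij' : 0 < c (i', j') := lt_of_le_of_ne (h0 _) (Ne.symm hij')
  -- The largest amount that can be moved without making a coefficient negative.
  set ε := min (c (i, j)) (c (i', j')) with hε
  have hεpos : 0 < ε := lt_min hcij hcij'
  set d : Fin N × Fin N → ℝ := Pi.single (i, j') 1 + Pi.single (i', j) 1 - Pi.single (i, j) 1
    - Pi.single (i', j') 1 with hd
  have hdsum : ∀ {E : Type} [AddCommGroup E] [Module ℝ E] (g : Fin N × Fin N → E),
      ∑ p, d p • g p = g (i, j') + g (i', j) - g (i, j) - g (i', j') := by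
    intro E _ _ g
    simp [hd, sub_smul, add_smul, Finset.sum_add_distrib, Finset.sum_sub_distrib,
      Pi.single_apply, ite_smul]
  have hnew : c + ε • d ∈ F := by
    refine ⟨⟨fun p => ?_, ?_⟩, ?_, fun p hp => ?_⟩
    · have hε1 : ε ≤ c (i, j) := min_le_left _ _
      have hε2 : ε ≤ c (i', j') := min_le_right _ _
      have hne : (i, j) ≠ (i', j') := fun h => hi.ne' (congrArg Prod.fst h)
      simp only [hd, Pi.add_apply, Pi.smul_apply, Pi.sub_apply, Pi.single_apply, smul_eq_mul]
      have := h0 p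
      by_cases e1 : p = (i, j)
      · subst e1
        simp [hj.ne, hi.ne', hne]
        linarith
      · by_cases e2 : p = (i', j')
        · subst e2
          simp [hj.ne', hi.ne]
          linarith
        · simp only [e1, e2, if_false, sub_zero]
          split_ifs <;> simp <;> nlinarith
    · have := hdsum (fun _ => (1 : ℝ))
      simp only [smul_eq_mul, mul_one] at this
      simp only [Pi.add_apply, Pi.smul_apply, smul_eq_mul, Finset.sum_add_distrib, h1,
        ← Finset.mul_sum, this]
      ring
    · have hw : boxWeight (i, j') + boxWeight (i', j) - boxWeight (i, j) - boxWeight (i', j') =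
          (0 : Fin N ⊕ Fin N → ℝ) := by
        simp only [boxWeight]
        abel
      have := hdsum (boxWeight (N := N))
      rw [hw] at this
      have h2' : ∑ p, c p • boxWeight p = z := h2
      simp [add_smul, mul_smul, Finset.sum_add_distrib, ← Finset.smul_sum, this, h2']
    · have q1 : p ≠ (i, j') := by rintro rfl; exact hp hμij
      have q2 : p ≠ (i', j) := by
        rintro rfl
        exact hp (hμ (Prod.mk_le_mk.2 ⟨hi.le, hj.le⟩ : (i', j) ≤ (i, j')) hμij)
      have q3 : p ≠ (i, j) := by
        rintro rfl
        exact hp (hμ (Prod.mk_le_mk.2 ⟨le_rfl, hj.le⟩ : (i, j) ≤ (i, j')) hμij)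
      have q4 : p ≠ (i', j') := by
        rintro rfl
        exact hp (hμ (Prod.mk_le_mk.2 ⟨hi.le, le_rfl⟩ : (i', j') ≤ (i, j')) hμij)
      simp [hd, h3 p hp, q1, q2, q3, q4]
  have hle : f (c + ε • d) ≤ f c := hmax hnew
  have hfd : f (c + ε • d) = f c + ε * (((i : ℝ) - i') * ((j' : ℝ) - j)) := by
    have := hdsum (fun p : Fin N × Fin N => (p.1 : ℝ) * (p.2 : ℝ))
    simp only [smul_eq_mul] at this
    simp only [hf, Pi.add_apply, Pi.smul_apply, smul_eq_mul, add_mul, Finset.sum_add_distrib,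
      mul_assoc, ← Finset.mul_sum, this]
    ring
  have hi1 : (i' : ℝ) < i := by exact_mod_cast hi
  have hj1 : (j : ℝ) < j' := by exact_mod_cast hj
  have : 0 < ε * (((i : ℝ) - i') * ((j' : ℝ) - j)) :=
    mul_pos hεpos (mul_pos (by linarith) (by linarith))
  linarith

end Noncrossing

/-! ### The complex of noncrossing sets of boxes -/

section Complex

variable {N : ℕ}

/-- The simplices spanned by the weights of noncrossing sets of boxes of the shape `μ`. -/
noncomputable def noncrossingComplex (μ : Finset (Fin N × Fin N)) :
    Geometry.SimplicialComplex ℝ (Fin N ⊕ Fin N → ℝ) where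
  faces := {s | s.Nonempty ∧ ∃ S : Finset (Fin N × Fin N), S ⊆ μ ∧
    IsNoncrossingIn (μ : Set (Fin N × Fin N)) S ∧
    (s : Set (Fin N ⊕ Fin N → ℝ)) = boxWeight '' (S : Set (Fin N × Fin N))}
  isRelLowerSet_faces := by
    classical
    rintro s ⟨hs, S, hSμ, hS, hsS⟩
    refine ⟨hs, fun t hts ht => ⟨ht, S.filter fun p => boxWeight p ∈ t,
      (Finset.filter_subset _ _).trans hSμ, hS.mono (Finset.coe_subset.2 (Finset.filter_subset _ _)), ?_⟩⟩
    ext x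
    constructor
    · intro hx
      have hxs : x ∈ (s : Set (Fin N ⊕ Fin N → ℝ)) := hts hx
      rw [hsS] at hxs
      obtain ⟨p, hp, rfl⟩ := hxs
      exact ⟨p, by simpa using ⟨hp, hx⟩, rfl⟩
    · rintro ⟨p, hp, rfl⟩
      exact (by simpa using hp : p ∈ S ∧ boxWeight p ∈ t).2
  indep := by
    rintro s ⟨-, S, hSμ, hS, hsS⟩
    have h := (hS.linearIndepOn hSμ).id_image
    rw [← hsS] at h
    exact LinearIndependent.affineIndependent ℝ h
  inter_subset_convexHull := by
    classical
    rintro s t ⟨-, S, hSμ, hS, hsS⟩ ⟨-, T, hTμ, hT, htT⟩ z ⟨hzs, hzt⟩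
    rw [hsS] at hzs
    rw [htT] at hzt
    obtain ⟨c, hc, hcS, hc1, hcz⟩ := (mem_convexHull_image_iff _ _ _).1 hzs
    obtain ⟨d, hd, hdT, hd1, hdz⟩ := (mem_convexHull_image_iff _ _ _).1 hzt
    -- A common point has only one expansion, so its support lies in both `S` and `T`.
    have hcd : c = d := IsNoncrossingIn.coeff_unique (hS.mono hcS) (hT.mono hdT)
      (fun p hp => hSμ (hcS p hp)) (fun p hp => hTμ (hdT p hp)) (fun p _ _ _ => hc p)
      (fun p _ _ _ => hd p) (hcz.trans hdz.symm)
    subst hcd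
    rw [hsS, htT, ← Set.image_inter boxWeight_injective, ← Finset.coe_inter]
    exact (mem_convexHull_image_iff _ _ _).2
      ⟨c, hc, fun p hp => Finset.mem_inter.2 ⟨hcS p hp, hdT p hp⟩, hc1, hcz⟩

theorem mem_faces_noncrossingComplex {μ : Finset (Fin N × Fin N)}
    {s : Finset (Fin N ⊕ Fin N → ℝ)} : s ∈ (noncrossingComplex μ).faces ↔
      s.Nonempty ∧ ∃ S : Finset (Fin N × Fin N), S ⊆ μ ∧
        IsNoncrossingIn (μ : Set (Fin N × Fin N)) S ∧
        (s : Set (Fin N ⊕ Fin N → ℝ)) = boxWeight '' (S : Set (Fin N × Fin N)) := Iff.rfl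

theorem isTriangulation_noncrossingComplex {μ : Finset (Fin N × Fin N)}
    (hμ : IsLowerSet (μ : Set (Fin N × Fin N))) :
    IsTriangulation (noncrossingComplex μ)
      (convexHull ℝ (boxWeight '' (μ : Set (Fin N × Fin N)))) := by
  classical
  refine ⟨?_, ?_, ?_⟩
  · refine ((μ.image boxWeight).powerset.finite_toSet).subset ?_
    rintro s ⟨-, S, hSμ, -, hsS⟩
    simp only [Finset.coe_powerset, Set.mem_preimage, Set.mem_powerset_iff, Finset.coe_image]
    rw [hsS]
    exact Set.image_mono (by exact_mod_cast hSμ)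
  · ext z
    rw [Geometry.SimplicialComplex.mem_space_iff]
    constructor
    · rintro ⟨s, ⟨-, S, hSμ, -, hsS⟩, hz⟩
      rw [hsS] at hz
      exact convexHull_mono (Set.image_mono (by exact_mod_cast hSμ)) hz
    · intro hz
      obtain ⟨c, hc, hcμ, hc1, hcz, hnc⟩ := exists_noncrossing_coeff hμ hz
      set S := Finset.univ.filter fun p => c p ≠ 0 with hS
      have hSc : (S : Set (Fin N × Fin N)) = {p | c p ≠ 0} := by simp [hS]
      have hzS : z ∈ convexHull ℝ (boxWeight '' (S : Set (Fin N × Fin N))) :=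
        (mem_convexHull_image_iff _ _ _).2 ⟨c, hc, fun p hp => by simp [hS, hp], hc1, hcz⟩
      refine ⟨S.image boxWeight, ⟨?_, S, fun p hp => hcμ p (by simpa [hS] using hp), ?_, ?_⟩, ?_⟩
      · rw [Finset.image_nonempty, ← Finset.coe_nonempty, ← Set.image_nonempty (f := boxWeight),
          ← convexHull_nonempty_iff (𝕜 := ℝ)]
        exact ⟨z, hzS⟩
      · rwa [hSc]
      · simp
      · simpa using hzS
  · intro x hx
    obtain ⟨-, S, hSμ, -, hsS⟩ := (Geometry.SimplicialComplex.mem_vertices).1 hx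
    have : x ∈ boxWeight '' (S : Set (Fin N × Fin N)) := by rw [← hsS]; simp
    obtain ⟨p, hp, rfl⟩ := this
    exact boxWeight_mem_extremePoints (hSμ hp)

theorem vectorSpan_convexHull {E : Type*} [AddCommGroup E] [Module ℝ E] (X : Set E) :
    vectorSpan ℝ (convexHull ℝ X) = vectorSpan ℝ X := by
  rw [← direction_affineSpan, affineSpan_convexHull, direction_affineSpan]

/-- A noncrossing set of boxes gives a simplex of full dimension iff it spans. -/
theorem IsNoncrossingIn.card_eq_iff {μ S : Finset (Fin N × Fin N)} (hμ : μ.Nonempty)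
    (hS : IsNoncrossingIn (μ : Set (Fin N × Fin N)) S) (hSμ : S ⊆ μ) :
    S.card = Module.finrank ℝ (vectorSpan ℝ
      (convexHull ℝ (boxWeight '' (μ : Set (Fin N × Fin N))))) + 1 ↔
    ∀ p ∈ μ, boxWeight p ∈ Submodule.span ℝ (boxWeight '' (S : Set (Fin N × Fin N))) := by
  classical
  have hdim := finrank_vectorSpan_add_one (X := boxWeight '' (μ : Set (Fin N × Fin N)))
    (Set.Nonempty.image _ hμ) (sumX N) (by rintro _ ⟨p, -, rfl⟩; exact sumX_boxWeight p)
  have hcard : Module.finrank ℝ (Submodule.span ℝ (boxWeight '' (S : Set (Fin N × Fin N)))) =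
      S.card := by
    have h := (hS.linearIndepOn hSμ).id_image
    rw [← Finset.coe_image] at h ⊢
    rw [finrank_span_finset_eq_card h, Finset.card_image_of_injective _ boxWeight_injective]
  have hle : Submodule.span ℝ (boxWeight '' (S : Set (Fin N × Fin N))) ≤
      Submodule.span ℝ (boxWeight '' (μ : Set (Fin N × Fin N))) :=
    Submodule.span_mono (Set.image_mono (by exact_mod_cast hSμ))
  rw [vectorSpan_convexHull, hdim, ← hcard]
  constructor
  · intro h p hp
    rw [Submodule.eq_of_le_of_finrank_eq hle h]
    exact Submodule.subset_span ⟨p, hp, rfl⟩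
  · intro h
    rw [le_antisymm hle (Submodule.span_le.2 (by rintro _ ⟨p, hp, rfl⟩; exact h p hp))]

/-- The weight of `p` is its own noncrossing expansion, and expansions are unique. Hence a simplex
determines its set of boxes. -/
theorem IsNoncrossingIn.mem_of_boxWeight_mem {μ S : Finset (Fin N × Fin N)}
    (hS : IsNoncrossingIn (μ : Set (Fin N × Fin N)) S) (hSμ : S ⊆ μ) {p : Fin N × Fin N}
    (hpμ : p ∈ μ)
    (hp : boxWeight p ∈ convexHull ℝ (boxWeight '' (S : Set (Fin N × Fin N)))) : p ∈ S := by
  classical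
  obtain ⟨c, hc, hcS, -, hcz⟩ := (mem_convexHull_image_iff _ _ _).1 hp
  have hsingle : ∀ q, (Pi.single p 1 : Fin N × Fin N → ℝ) q ≠ 0 → q = p := by
    intro q hq
    by_contra h
    simp [h] at hq
  have key : c = Pi.single p 1 := by
    refine IsNoncrossingIn.coeff_unique (μ := μ) (hS.mono hcS) ?_ (fun q hq => hSμ (hcS q hq))
      (fun q hq => hsingle q hq ▸ hpμ) (fun q _ _ _ => hc q) (fun q _ _ _ => ?_) ?_
    · intro i j i' j' h1 h2 hi
      have e1 := hsingle _ h1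
      have e2 := hsingle _ h2
      exact absurd (congrArg Prod.fst (e1.trans e2.symm)) hi.ne'
    · rw [Pi.single_apply]
      split_ifs <;> norm_num
    · simp [hcz, Pi.single_apply, ite_smul]
  exact hcS p (by simp [key])

theorem convexHull_injOn {μ S S' : Finset (Fin N × Fin N)}
    (hS : IsNoncrossingIn (μ : Set (Fin N × Fin N)) S) (hSμ : S ⊆ μ)
    (hS' : IsNoncrossingIn (μ : Set (Fin N × Fin N)) S') (hSμ' : S' ⊆ μ)
    (h : convexHull ℝ (boxWeight '' (S : Set (Fin N × Fin N))) =
      convexHull ℝ (boxWeight '' (S' : Set (Fin N × Fin N)))) : S = S' := by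
  apply Finset.Subset.antisymm
  · exact fun p hp => hS'.mem_of_boxWeight_mem hSμ' (hSμ hp)
      (h ▸ subset_convexHull ℝ _ ⟨p, hp, rfl⟩)
  · exact fun p hp => hS.mem_of_boxWeight_mem hSμ (hSμ' hp)
      (h ▸ subset_convexHull ℝ _ ⟨p, hp, rfl⟩)

end Complex

/-! ### Labelled shapes and their graphs -/

/-- The rows and columns of the nonempty shape `μ` are labelled by a linearly ordered set, in such
a way that the order of labels records the shape. -/
structure IsLabelling {N : ℕ} {V : Type*} [LinearOrder V] (μ : Finset (Fin N × Fin N))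
    (a b : Fin N → V) : Prop where
  nonempty : μ.Nonempty
  lower : IsLowerSet (μ : Set (Fin N × Fin N))
  -- Equality of labels is allowed: it occurs only at maximal boxes of `μ`, where a row and a column
  -- share one vertex.
  mem_iff : ∀ p ∈ μ, ∀ q ∈ μ, (p.1, q.2) ∈ μ ↔ b q.2 ≤ a p.1
  row_lt : ∀ p ∈ μ, ∀ i, i < p.1 → a p.1 < a i
  col_lt : ∀ p ∈ μ, ∀ j, j < p.2 → b j < b p.2
  surj : ∀ v, (∃ p ∈ μ, a p.1 = v) ∨ ∃ p ∈ μ, b p.2 = v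

namespace IsLabelling

variable {N : ℕ} {V : Type*} [LinearOrder V] {μ : Finset (Fin N × Fin N)} {a b : Fin N → V}

theorem le (h : IsLabelling μ a b) {p : Fin N × Fin N} (hp : p ∈ μ) : b p.2 ≤ a p.1 :=
  (h.mem_iff p hp p hp).1 hp

theorem row_lt_of_lt (h : IsLabelling μ a b) {p q : Fin N × Fin N} (hq : q ∈ μ)
    (hpq : a p.1 < a q.1) : q.1 < p.1 := by
  by_contra! hle
  rcases hle.lt_or_eq with hlt | heq
  · exact (h.row_lt q hq _ hlt).not_gt hpq
  · rw [heq] at hpq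
    exact hpq.false

theorem col_lt_of_lt (h : IsLabelling μ a b) {p q : Fin N × Fin N} (hp : p ∈ μ)
    (hpq : b p.2 < b q.2) : p.2 < q.2 := by
  by_contra! hle
  rcases hle.lt_or_eq with hlt | heq
  · exact (h.col_lt p hp _ hlt).not_gt hpq
  · rw [heq] at hpq
    exact hpq.false

theorem row_inj (h : IsLabelling μ a b) {p q : Fin N × Fin N} (hp : p ∈ μ) (hq : q ∈ μ)
    (hpq : a p.1 = a q.1) : p.1 = q.1 := by
  rcases lt_trichotomy p.1 q.1 with hlt | heq | hlt
  · exact absurd hpq (h.row_lt q hq _ hlt).ne'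
  · exact heq
  · exact absurd hpq (h.row_lt p hp _ hlt).ne

theorem col_inj (h : IsLabelling μ a b) {p q : Fin N × Fin N} (hp : p ∈ μ) (hq : q ∈ μ)
    (hpq : b p.2 = b q.2) : p.2 = q.2 := by
  rcases lt_trichotomy p.2 q.2 with hlt | heq | hlt
  · exact absurd hpq (h.col_lt q hq _ hlt).ne
  · exact heq
  · exact absurd hpq (h.col_lt p hp _ hlt).ne'

theorem eq_of_labels_eq (h : IsLabelling μ a b) {p q : Fin N × Fin N} (hp : p ∈ μ) (hq : q ∈ μ)
    (hb : b p.2 = b q.2) (ha : a p.1 = a q.1) : p = q :=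
  Prod.ext (h.row_inj hp hq ha) (h.col_inj hp hq hb)

/-- By contraposition, boxes with coinciding labels are maximal in `μ`. These are the boxes where
`IsNoncrossingIn.coeff_unique` tolerates negative coefficients. -/
theorem lt_of_lt (h : IsLabelling μ a b) {p q : Fin N × Fin N} (hq : q ∈ μ) (hpq : p < q) :
    b p.2 < a p.1 := by
  rcases Prod.lt_iff.1 hpq with ⟨h1, h2⟩ | ⟨h1, h2⟩
  · refine lt_of_le_of_lt ?_ ((h.le hq).trans_lt (h.row_lt q hq _ h1))
    rcases h2.lt_or_eq with h3 | h3
    · exact (h.col_lt q hq _ h3).le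
    · rw [h3]
  · refine lt_of_lt_of_le (h.col_lt q hq _ h2) ((h.le hq).trans ?_)
    rcases h1.lt_or_eq with h3 | h3
    · exact (h.row_lt q hq _ h3).le
    · rw [h3]

end IsLabelling

theorem eq_of_reachable {W α : Type*} {T : SimpleGraph W} {f : W → α}
    (hf : ∀ u v, T.Adj u v → f u = f v) {u v : W} (huv : T.Reachable u v) : f u = f v := by
  obtain ⟨p⟩ := huv
  induction p with
  | nil => rfl
  | cons hadj _ ih => exact (hf _ _ hadj).trans ih

section Graphs

variable {N : ℕ} {V : Type*} [LinearOrder V] {μ S : Finset (Fin N × Fin N)} {a b : Fin N → V}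

/-- The graph whose edges join the labels of the boxes in `S`. -/
def boxGraph (a b : Fin N → V) (S : Finset (Fin N × Fin N)) : SimpleGraph V :=
  SimpleGraph.fromRel fun u v => ∃ p ∈ S, b p.2 = u ∧ a p.1 = v

open Classical in
/-- The boxes whose labels coincide or are joined by an edge of `T`. -/
noncomputable def treeBoxes (μ : Finset (Fin N × Fin N)) (a b : Fin N → V) (T : SimpleGraph V) :
    Finset (Fin N × Fin N) :=
  μ.filter fun p => b p.2 = a p.1 ∨ T.Adj (b p.2) (a p.1)

theorem mem_treeBoxes {T : SimpleGraph V} {p : Fin N × Fin N} :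
    p ∈ treeBoxes μ a b T ↔ p ∈ μ ∧ (b p.2 = a p.1 ∨ T.Adj (b p.2) (a p.1)) := by
  simp [treeBoxes]

theorem treeBoxes_subset (T : SimpleGraph V) : treeBoxes μ a b T ⊆ μ :=
  fun _ hp => (mem_treeBoxes.1 hp).1

theorem boxGraph_adj_iff (h : IsLabelling μ a b) (hSμ : S ⊆ μ) {u v : V} (huv : u < v) :
    (boxGraph a b S).Adj u v ↔ ∃ p ∈ S, b p.2 = u ∧ a p.1 = v := by
  rw [boxGraph, SimpleGraph.fromRel_adj]
  refine ⟨?_, fun hp => ⟨huv.ne, Or.inl hp⟩⟩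
  rintro ⟨-, hp | ⟨p, hp, rfl, rfl⟩⟩
  · exact hp
  · exact absurd (h.le (hSμ hp)) huv.not_ge

/-- For boxes `(i,j)`, `(i',j')` with `i' < i` and `j < j'`, the forbidden condition `(i,j') ∈ μ`
reads `b j' ≤ a i`. Strict inequality is a crossing of the two arcs; equality is a failure of
alternation. The next two lemmas rest on the same translation. -/
theorem isNoncrossing_boxGraph (h : IsLabelling μ a b) (hSμ : S ⊆ μ)
    (hS : IsNoncrossingIn (μ : Set (Fin N × Fin N)) S) : IsNoncrossing (boxGraph a b S) := by
  rintro i j k l hij hjk hkl ⟨h1, h2⟩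
  obtain ⟨p, hp, rfl, rfl⟩ := (boxGraph_adj_iff h hSμ (hij.trans hjk)).1 h1
  obtain ⟨q, hq, rfl, rfl⟩ := (boxGraph_adj_iff h hSμ (hjk.trans hkl)).1 h2
  exact hS p.1 p.2 q.1 q.2 hp hq (h.row_lt_of_lt (hSμ hq) hkl) (h.col_lt_of_lt (hSμ hp) hij)
    ((h.mem_iff p (hSμ hp) q (hSμ hq)).2 hjk.le)

theorem isAlternating_boxGraph (h : IsLabelling μ a b) (hSμ : S ⊆ μ)
    (hS : IsNoncrossingIn (μ : Set (Fin N × Fin N)) S) : IsAlternating (boxGraph a b S) := by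
  rintro i j k hij hjk ⟨h1, h2⟩
  obtain ⟨p, hp, rfl, rfl⟩ := (boxGraph_adj_iff h hSμ hij).1 h1
  obtain ⟨q, hq, hqp, rfl⟩ := (boxGraph_adj_iff h hSμ hjk).1 h2
  exact hS p.1 p.2 q.1 q.2 hp hq (h.row_lt_of_lt (hSμ hq) hjk)
    (h.col_lt_of_lt (hSμ hp) (hqp ▸ hij)) ((h.mem_iff p (hSμ hp) q (hSμ hq)).2 hqp.le)

theorem isNoncrossingIn_treeBoxes (h : IsLabelling μ a b) {T : SimpleGraph V}
    (hT : IsNoncrossing T) (hT' : IsAlternating T) :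
    IsNoncrossingIn (μ : Set (Fin N × Fin N)) (treeBoxes μ a b T) := by
  intro i j i' j' hp hq hi hj hμ
  obtain ⟨hp, hp'⟩ := mem_treeBoxes.1 (Finset.mem_coe.1 hp)
  obtain ⟨hq, hq'⟩ := mem_treeBoxes.1 (Finset.mem_coe.1 hq)
  have h1 : b j < b j' := h.col_lt _ hq _ hj
  have h2 : a i < a i' := h.row_lt _ hp _ hi
  have h3 : b j' ≤ a i := h.le hμ
  have hp'' : T.Adj (b j) (a i) := hp'.resolve_left (h1.trans_le h3).ne
  have hq'' : T.Adj (b j') (a i') := hq'.resolve_left (h3.trans_lt h2).ne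
  rcases h3.lt_or_eq with h4 | h4
  · exact hT _ _ _ _ h1 h4 h2 ⟨hp'', hq''⟩
  · rw [← h4] at hp'' h2
    exact hT' _ _ _ h1 h2 ⟨hp'', hq''⟩

/-- Boxes with coinciding labels would be loops and leave no trace in the graph, so `S` can be
recovered only if it contains all of them. -/
theorem treeBoxes_boxGraph (h : IsLabelling μ a b) (hSμ : S ⊆ μ)
    (hdiag : ∀ p ∈ μ, b p.2 = a p.1 → p ∈ S) : treeBoxes μ a b (boxGraph a b S) = S := by
  ext p
  rw [mem_treeBoxes]
  constructor
  · rintro ⟨hp, hp' | hp'⟩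
    · exact hdiag p hp hp'
    · obtain ⟨q, hq, hqb, hqa⟩ :=
        (boxGraph_adj_iff h hSμ (lt_of_le_of_ne (h.le hp) hp'.ne)).1 hp'
      rwa [← h.eq_of_labels_eq (hSμ hq) hp hqb hqa]
  · intro hp
    refine ⟨hSμ hp, ?_⟩
    rcases (h.le (hSμ hp)).lt_or_eq with hlt | heq
    · exact Or.inr ((boxGraph_adj_iff h hSμ hlt).2 ⟨p, hp, rfl, rfl⟩)
    · exact Or.inl heq

theorem boxGraph_treeBoxes (h : IsLabelling μ a b) {T G : SimpleGraph V}
    (hG : ∀ u v, u < v → (G.Adj u v ↔ ∃ p ∈ μ, b p.2 = u ∧ a p.1 = v)) (hTG : T ≤ G) :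
    boxGraph a b (treeBoxes μ a b T) = T := by
  have key : ∀ u v, u < v → ((boxGraph a b (treeBoxes μ a b T)).Adj u v ↔ T.Adj u v) := by
    intro u v huv
    rw [boxGraph_adj_iff h (treeBoxes_subset T) huv]
    constructor
    · rintro ⟨p, hp, rfl, rfl⟩
      exact (mem_treeBoxes.1 hp).2.resolve_left huv.ne
    · intro hT
      obtain ⟨p, hp, rfl, rfl⟩ := (hG u v huv).1 (hTG hT)
      exact ⟨p, mem_treeBoxes.2 ⟨hp, Or.inr hT⟩, rfl, rfl⟩
  ext u v
  rcases lt_trichotomy u v with huv | rfl | huv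
  · exact key u v huv
  · simp
  · rw [SimpleGraph.adj_comm, key v u huv, SimpleGraph.adj_comm]

/-- A functional that vanishes on the boxes with coinciding labels comes from a function on the
labels. -/
theorem IsLabelling.exists_potential (h : IsLabelling μ a b)
    (g : (Fin N ⊕ Fin N → ℝ) →ₗ[ℝ] ℝ) (hg : ∀ p ∈ μ, b p.2 = a p.1 → g (boxWeight p) = 0) :
    ∃ f : V → ℝ, ∀ p ∈ μ, g (boxWeight p) = f (a p.1) - f (b p.2) := by
  have hw : ∀ p : Fin N × Fin N, g (boxWeight p) =
      g (Pi.single (Sum.inl p.1) 1) - g (Pi.single (Sum.inr p.2) 1) := fun p => by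
    rw [boxWeight, map_sub]
  -- A vertex may label both a row and a column. They meet in a box with coinciding labels, where
  -- `g` vanishes, so both prescriptions for the value at this vertex agree.
  have hex : ∀ v, ∃ t : ℝ, (∀ p ∈ μ, a p.1 = v → g (Pi.single (Sum.inl p.1) 1) = t) ∧
      ∀ p ∈ μ, b p.2 = v → g (Pi.single (Sum.inr p.2) 1) = t := by
    intro v
    have hdiag : ∀ p ∈ μ, ∀ q ∈ μ, b q.2 = a p.1 →
        g (Pi.single (Sum.inr q.2) 1) = g (Pi.single (Sum.inl p.1) 1) := by
      intro p hp q hq hqp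
      have := hg (p.1, q.2) ((h.mem_iff p hp q hq).2 hqp.le) hqp
      rw [hw] at this
      exact (sub_eq_zero.1 this).symm
    rcases h.surj v with ⟨p, hp, rfl⟩ | ⟨p, hp, rfl⟩
    · exact ⟨_, fun q hq hqp => by rw [h.row_inj hq hp hqp], fun q hq hqp => hdiag p hp q hq hqp⟩
    · exact ⟨_, fun q hq hqp => (hdiag q hq p hp hqp.symm).symm,
        fun q hq hqp => by rw [h.col_inj hq hp hqp]⟩
  choose f hf1 hf2 using hex
  exact ⟨f, fun p hp => by rw [hw, hf1 _ p hp rfl, hf2 _ p hp rfl]⟩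

/-- A functional vanishing on the tree boxes is a difference of potentials, and the potential is
constant along the edges of the connected graph `T`. So the functional vanishes on every box of `μ`.
-/
theorem mem_span_treeBoxes (h : IsLabelling μ a b) {T : SimpleGraph V}
    (hG : boxGraph a b (treeBoxes μ a b T) = T) (hT : T.Connected) :
    ∀ p ∈ μ, boxWeight p ∈
      Submodule.span ℝ (boxWeight '' (treeBoxes μ a b T : Set (Fin N × Fin N))) := by
  intro p hp
  by_contra hnot
  obtain ⟨g, hgp, hg⟩ := Submodule.exists_le_ker_of_notMem hnot
  have hgS : ∀ q ∈ treeBoxes μ a b T, g (boxWeight q) = 0 :=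
    fun q hq => hg (Submodule.subset_span ⟨q, hq, rfl⟩)
  obtain ⟨f, hf⟩ := h.exists_potential g
    fun q hq hq' => hgS q (mem_treeBoxes.2 ⟨hq, Or.inl hq'⟩)
  have hadj : ∀ u v, T.Adj u v → f u = f v := by
    intro u v huv
    rw [← hG, boxGraph, SimpleGraph.fromRel_adj] at huv
    rcases huv with ⟨-, ⟨q, hq, rfl, rfl⟩ | ⟨q, hq, rfl, rfl⟩⟩
    all_goals
      have h1 := hf q (treeBoxes_subset T hq)
      rw [hgS q hq] at h1
      linarith
  apply hgp
  rw [hf p hp, eq_of_reachable hadj (hT.preconnected (a p.1) (b p.2)), sub_self]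

/-- Both boxes of a forbidden pair lie strictly below the box `(i, j')` of `μ`, whereas a box with
coinciding labels is maximal. -/
theorem isNoncrossingIn_insert (h : IsLabelling μ a b)
    (hS : IsNoncrossingIn (μ : Set (Fin N × Fin N)) S) {p : Fin N × Fin N} (hp : p ∈ μ)
    (hpd : b p.2 = a p.1) :
    IsNoncrossingIn (μ : Set (Fin N × Fin N)) (insert p S : Finset (Fin N × Fin N)) := by
  intro i j i' j' h1 h2 hi hj hμ
  rw [Finset.mem_coe, Finset.mem_insert] at h1 h2
  rcases h1 with rfl | h1
  · exact (h.lt_of_lt hμ (Prod.mk_lt_mk_iff_right.2 hj)).ne hpd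
  · rcases h2 with rfl | h2
    · exact (h.lt_of_lt hμ (Prod.mk_lt_mk_iff_left.2 hi)).ne hpd
    · exact hS i j i' j' h1 h2 hi hj hμ

/-- Adding a missing corner would keep the set noncrossing, hence independent, although `S` already
spans. -/
theorem mem_of_spans (h : IsLabelling μ a b) (hSμ : S ⊆ μ)
    (hS : IsNoncrossingIn (μ : Set (Fin N × Fin N)) S)
    (hspan : ∀ p ∈ μ, boxWeight p ∈ Submodule.span ℝ (boxWeight '' (S : Set (Fin N × Fin N))))
    {p : Fin N × Fin N} (hp : p ∈ μ) (hpd : b p.2 = a p.1) : p ∈ S := by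
  by_contra hpS
  have hind := (isNoncrossingIn_insert h hS hp hpd).linearIndepOn
    (Finset.insert_subset hp hSμ)
  rw [Finset.coe_insert] at hind
  exact hind.notMem_span_of_insert (by simpa using hpS) (hspan p hp)

/-- The functional on `ℝ^V` with coefficients `f`. -/
noncomputable def potentialFunctional [Fintype V] (f : V → ℝ) : (V → ℝ) →ₗ[ℝ] ℝ :=
  ∑ v, f v • LinearMap.proj v

theorem potentialFunctional_rootVec [Fintype V] (f : V → ℝ) (u v : V) :
    potentialFunctional f (rootVec u v) = f u - f v := by
  simp [potentialFunctional, rootVec, LinearMap.sum_apply, mul_sub, Finset.sum_sub_distrib,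
    Pi.single_apply]

theorem isTree_boxGraph [Fintype V] (h : IsLabelling μ a b) (hSμ : S ⊆ μ)
    (hS : IsNoncrossingIn (μ : Set (Fin N × Fin N)) S)
    (hspan : ∀ p ∈ μ, boxWeight p ∈ Submodule.span ℝ (boxWeight '' (S : Set (Fin N × Fin N))))
    (Λ : (Fin N ⊕ Fin N → ℝ) →ₗ[ℝ] (V → ℝ))
    (hΛ : ∀ p ∈ μ, Λ (boxWeight p) = rootVec (b p.2) (a p.1)) : (boxGraph a b S).IsTree := by
  classical
  obtain ⟨p₀, hp₀⟩ := h.nonempty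
  have hne : Nonempty V := ⟨a p₀.1⟩
  rw [SimpleGraph.isTree_iff, SimpleGraph.connected_iff]
  refine ⟨⟨?_, hne⟩, ?_⟩
  · intro u v
    by_contra huv
    -- The indicator of a component, pulled back along `Λ`, kills `S` and hence all of `μ`. All
    -- labels are linked through the first row and column, so the indicator is constant.
    set f : V → ℝ := fun x => if (boxGraph a b S).Reachable u x then 1 else 0 with hf
    have hfadj : ∀ x y, (boxGraph a b S).Adj x y → f x = f y := by
      intro x y hxy
      have : (boxGraph a b S).Reachable u x ↔ (boxGraph a b S).Reachable u y :=
        ⟨fun hr => hr.trans hxy.reachable, fun hr => hr.trans hxy.symm.reachable⟩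
      simp [hf, this]
    have hker : Submodule.span ℝ (boxWeight '' (S : Set (Fin N × Fin N))) ≤
        LinearMap.ker (potentialFunctional f ∘ₗ Λ) := by
      rw [Submodule.span_le]
      rintro _ ⟨p, hp, rfl⟩
      have hpμ := hSμ hp
      rw [SetLike.mem_coe, LinearMap.mem_ker, LinearMap.comp_apply, hΛ p hpμ,
        potentialFunctional_rootVec, sub_eq_zero]
      rcases (h.le hpμ).lt_or_eq with hlt | heq
      · exact hfadj _ _ ((boxGraph_adj_iff h hSμ hlt).2 ⟨p, hp, rfl, rfl⟩)
      · rw [heq]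
    have hbox : ∀ p ∈ μ, f (b p.2) = f (a p.1) := by
      intro p hp
      have := hker (hspan p hp)
      rw [LinearMap.mem_ker, LinearMap.comp_apply, hΛ p hp, potentialFunctional_rootVec,
        sub_eq_zero] at this
      exact this
    have hN : 0 < N := (Nat.zero_le _).trans_lt p₀.1.isLt
    have hzero : ∀ i : Fin N, (⟨0, hN⟩ : Fin N) ≤ i := fun i => Nat.zero_le i.val
    have hconst : ∀ x, f x = f (a ⟨0, hN⟩) := by
      intro x
      rcases h.surj x with ⟨p, hp, rfl⟩ | ⟨p, hp, rfl⟩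
      · have h1 : (p.1, (⟨0, hN⟩ : Fin N)) ∈ μ :=
          h.lower (Prod.mk_le_mk.2 ⟨le_rfl, hzero _⟩ : (p.1, (⟨0, hN⟩ : Fin N)) ≤ p) hp
        have h2 : ((⟨0, hN⟩ : Fin N), (⟨0, hN⟩ : Fin N)) ∈ μ :=
          h.lower (Prod.mk_le_mk.2 ⟨hzero _, hzero _⟩ : (⟨0, hN⟩, ⟨0, hN⟩) ≤ p) hp
        exact (hbox _ h1).symm.trans (hbox _ h2)
      · exact hbox _ (h.lower
          (Prod.mk_le_mk.2 ⟨hzero _, le_rfl⟩ : ((⟨0, hN⟩ : Fin N), p.2) ≤ p) hp)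
    have := (hconst u).trans (hconst v).symm
    simp [hf, huv] at this
  -- By independence some functional kills all of `S` except the box of a given edge. Its potential
  -- is constant along all other edges, so these cannot join the ends of that edge.
  · rw [SimpleGraph.isAcyclic_iff_forall_adj_isBridge]
    have key : ∀ u v, u < v → (boxGraph a b S).Adj u v →
        (boxGraph a b S).IsBridge s(u, v) := by
      intro u v huv hadj
      obtain ⟨p, hp, rfl, rfl⟩ := (boxGraph_adj_iff h hSμ huv).1 hadj
      rw [SimpleGraph.isBridge_iff]
      intro hreach
      have hind := hS.linearIndepOn hSμ
      rw [← Finset.insert_erase hp, Finset.coe_insert] at hind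
      obtain ⟨g, hgp, hg⟩ := Submodule.exists_le_ker_of_notMem
        (hind.notMem_span_of_insert (by simp))
      have hgS : ∀ q ∈ S, q ≠ p → g (boxWeight q) = 0 :=
        fun q hq hqp => hg (Submodule.subset_span ⟨q, by simp [hq, hqp], rfl⟩)
      obtain ⟨f, hf⟩ := h.exists_potential g fun q hq hqd =>
        hgS q (mem_of_spans h hSμ hS hspan hq hqd) (by rintro rfl; exact huv.ne hqd)
      have hstep : ∀ x y, ((boxGraph a b S).deleteEdges {s(b p.2, a p.1)}).Adj x y →
          f x = f y := by
        intro x y hxy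
        rw [SimpleGraph.deleteEdges_adj, boxGraph, SimpleGraph.fromRel_adj] at hxy
        rcases hxy with ⟨⟨-, ⟨q, hq, rfl, rfl⟩ | ⟨q, hq, rfl, rfl⟩⟩, hne⟩
        all_goals
          have h1 := hf q (hSμ hq)
          rw [hgS q hq (by rintro rfl; simp [Sym2.eq_swap] at hne)] at h1
          linarith
      apply hgp
      rw [hf p (hSμ hp), eq_of_reachable hstep hreach, sub_self]
    intro u v hadj
    rcases lt_or_gt_of_ne hadj.ne with huv | huv
    · exact key u v huv hadj
    · rw [Sym2.eq_swap]
      exact key v u huv hadj.symm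

end Graphs

/-! ### Preimages of the simplices of the root polytope -/

section Preimage

variable {N : ℕ} {V : Type*} [LinearOrder V] {μ : Finset (Fin N × Fin N)} {a b : Fin N → V}

theorem acyclicRootPolytope_subset_rootCone (G : SimpleGraph V) :
    acyclicRootPolytope G ⊆ (rootCone G : Set (V → ℝ)) := by
  refine convexHull_min ?_ (rootCone G).convex
  rintro x (rfl | ⟨i, j, -, -, hx⟩)
  · exact (rootCone G).zero_mem
  · exact hx

theorem convex_acyclicRootPolytope (G : SimpleGraph V) : Convex ℝ (acyclicRootPolytope G) :=
  convex_convexHull ℝ _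

theorem rootVec_mem_acyclicRootPolytope {G : SimpleGraph V} {u v : V} (huv : u < v)
    (hadj : G.Adj u v) : rootVec u v ∈ acyclicRootPolytope G :=
  subset_convexHull ℝ _ (Or.inr ⟨u, v, huv, rfl, Submodule.subset_span ⟨u, v, huv, hadj, rfl⟩⟩)

theorem zero_mem_acyclicRootPolytope (G : SimpleGraph V) : (0 : V → ℝ) ∈ acyclicRootPolytope G :=
  subset_convexHull ℝ _ (Or.inl rfl)

/-- An edge of an acyclic graph splits off a function that is nonnegative on the cone of the graph
and recovers the coefficient of this edge. -/
theorem exists_edge_functional [Fintype V] {T : SimpleGraph V} (hT : T.IsAcyclic) {u v : V}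
    (huv : u < v) (hadj : T.Adj u v) : ∃ f : V → ℝ, f u - f v = 1 ∧
      (∀ x y, x < y → T.Adj x y → (x, y) ≠ (u, v) → f x - f y = 0) ∧
      ∀ z ∈ rootCone T, 0 ≤ potentialFunctional f z := by
  classical
  have hbr := SimpleGraph.isBridge_iff.1 (SimpleGraph.isAcyclic_iff_forall_adj_isBridge.1 hT hadj)
  set T' := T.deleteEdges {s(u, v)} with hT'
  -- The indicator of the side of `u` after the bridge is removed: it drops by `1` across this edge
  -- and is constant along every other.
  set f : V → ℝ := fun x => if T'.Reachable u x then 1 else 0 with hf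
  have h1 : f u - f v = 1 := by simp [hf, hbr]
  have h2 : ∀ x y, x < y → T.Adj x y → (x, y) ≠ (u, v) → f x - f y = 0 := by
    intro x y hxy hxyadj hne
    have hadj' : T'.Adj x y := by
      rw [hT', SimpleGraph.deleteEdges_adj]
      refine ⟨hxyadj, fun hmem => ?_⟩
      rcases Sym2.eq_iff.1 (Set.mem_singleton_iff.1 hmem) with ⟨rfl, rfl⟩ | ⟨rfl, rfl⟩
      · exact hne rfl
      · exact huv.not_gt hxy
    have : T'.Reachable u x ↔ T'.Reachable u y :=
      ⟨fun hr => hr.trans hadj'.reachable, fun hr => hr.trans hadj'.symm.reachable⟩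
    simp [hf, this]
  refine ⟨f, h1, h2, fun z hz => ?_⟩
  induction hz using Submodule.span_induction with
  | mem x hx =>
    obtain ⟨i, j, hij, hadjij, rfl⟩ := hx
    rw [potentialFunctional_rootVec]
    by_cases hne : (i, j) = (u, v)
    · obtain ⟨rfl, rfl⟩ := Prod.mk.inj hne
      rw [h1]; exact zero_le_one
    · rw [h2 i j hij hadjij hne]
  | zero => simp
  | add x y _ _ hx hy => rw [map_add]; exact add_nonneg hx hy
  | smul t x _ hx =>
    have : t • x = (t : ℝ) • x := rfl
    rw [this, map_smul]
    exact mul_nonneg t.2 hx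

/-- For the nontrivial inclusion, expand `z` once over noncrossing boxes with convex coefficients
`d`, and once over the spanning set of tree boxes with real coefficients `c`. Membership of `Λ z` in
the cone of `T` gives `c ≥ 0` at the edges of `T`; at boxes with coinciding labels nothing is known,
but these are maximal. Uniqueness gives `c = d`. -/
theorem preimage_acyclicRootPolytope [Fintype V] (h : IsLabelling μ a b) {T : SimpleGraph V}
    (hG : boxGraph a b (treeBoxes μ a b T) = T) (hT : T.IsTree) (hnc : IsNoncrossing T)
    (halt : IsAlternating T) (Λ : (Fin N ⊕ Fin N → ℝ) →ₗ[ℝ] (V → ℝ))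
    (hΛ : ∀ p ∈ μ, Λ (boxWeight p) = rootVec (b p.2) (a p.1)) :
    {z | z ∈ convexHull ℝ (boxWeight '' (μ : Set (Fin N × Fin N))) ∧
      Λ z ∈ acyclicRootPolytope T} =
    convexHull ℝ (boxWeight '' (treeBoxes μ a b T : Set (Fin N × Fin N))) := by
  classical
  rw [SimpleGraph.isTree_iff] at hT
  have hSμ : treeBoxes μ a b T ⊆ μ := treeBoxes_subset T
  have hSnc := isNoncrossingIn_treeBoxes h hnc halt
  apply Set.Subset.antisymm
  · rintro z ⟨hz, hzT⟩
    obtain ⟨d, hd, hdμ, hd1, hdz, hdnc⟩ := exists_noncrossing_coeff h.lower hz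
    have hzspan : z ∈ Submodule.span ℝ
        (boxWeight '' (treeBoxes μ a b T : Set (Fin N × Fin N))) := by
      rw [← hdz]
      refine Submodule.sum_mem _ fun p _ => ?_
      by_cases hp : d p = 0
      · simp [hp]
      · exact Submodule.smul_mem _ _ (mem_span_treeBoxes h hG hT.1 p (hdμ p hp))
    obtain ⟨c, hcS, hcz⟩ := (mem_span_image_iff _ _ _).1 hzspan
    have hcpos : ∀ p q, q ∈ μ → p < q → 0 ≤ c p := by
      intro p q hq hpq
      by_cases hcp : c p = 0
      · rw [hcp]
      have hlt := h.lt_of_lt hq hpq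
      have hp := mem_treeBoxes.1 (hcS p hcp)
      obtain ⟨f, hf1, hf2, hf3⟩ := exists_edge_functional hT.2 hlt (hp.2.resolve_left hlt.ne)
      have hval : potentialFunctional f (Λ z) = c p := by
        rw [← hcz, map_sum, map_sum, Finset.sum_eq_single p]
        · rw [map_smul, map_smul, hΛ p hp.1, potentialFunctional_rootVec, hf1, smul_eq_mul, mul_one]
        · intro r _ hrp
          by_cases hcr : c r = 0
          · simp [hcr]
          have hr := mem_treeBoxes.1 (hcS r hcr)
          rw [map_smul, map_smul, hΛ r hr.1, potentialFunctional_rootVec]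
          rcases (h.le hr.1).lt_or_eq with hlt' | heq
          · rw [hf2 _ _ hlt' (hr.2.resolve_left hlt'.ne), smul_zero]
            intro heq
            obtain ⟨e1, e2⟩ := Prod.mk.inj heq
            exact hrp (h.eq_of_labels_eq hr.1 hp.1 e1 e2)
          · rw [heq, sub_self, smul_zero]
        · simp
      rw [← hval]
      exact hf3 _ (acyclicRootPolytope_subset_rootCone T hzT)
    have hcd : c = d := IsNoncrossingIn.coeff_unique (hSnc.mono hcS) hdnc
      (fun p hp => hSμ (hcS p hp)) hdμ hcpos (fun p _ _ _ => hd p) (hcz.trans hdz.symm)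
    subst hcd
    exact (mem_convexHull_image_iff _ _ _).2 ⟨c, hd, hcS, hd1, hcz⟩
  · refine convexHull_min ?_ ?_
    · rintro _ ⟨p, hp, rfl⟩
      obtain ⟨hpμ, hp'⟩ := mem_treeBoxes.1 (Finset.mem_coe.1 hp)
      refine ⟨subset_convexHull ℝ _ ⟨p, hpμ, rfl⟩, ?_⟩
      rw [hΛ p hpμ]
      rcases (h.le hpμ).lt_or_eq with hlt | heq
      · exact rootVec_mem_acyclicRootPolytope hlt (hp'.resolve_left hlt.ne)
      · rw [heq, rootVec, sub_self]
        exact zero_mem_acyclicRootPolytope T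
    · exact (convex_convexHull ℝ _).inter ((convex_acyclicRootPolytope T).linear_preimage Λ)

/-- Pulling back the canonical triangulation of a root polytope gives the noncrossing triangulation
of the polytope of a labelled shape. -/
theorem bijOn_preimage [Fintype V] (h : IsLabelling μ a b) {G : SimpleGraph V}
    (hG : ∀ u v, u < v → ((dirTransClosure G).Adj u v ↔ ∃ p ∈ μ, b p.2 = u ∧ a p.1 = v))
    (Λ : (Fin N ⊕ Fin N → ℝ) →ₗ[ℝ] (V → ℝ))
    (hΛ : ∀ p ∈ μ, Λ (boxWeight p) = rootVec (b p.2) (a p.1)) :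
    Set.BijOn (fun Δ => {z | z ∈ convexHull ℝ (boxWeight '' (μ : Set (Fin N × Fin N))) ∧ Λ z ∈ Δ})
      (canonicalTopSimplices G)
      (topSimplices (noncrossingComplex μ)
        (convexHull ℝ (boxWeight '' (μ : Set (Fin N × Fin N))))) := by
  classical
  refine ⟨?_, ?_, ?_⟩
  · rintro _ ⟨T, hTG, hT, hnc, halt, rfl⟩
    have hTS := boxGraph_treeBoxes h hG hTG
    have hSnc := isNoncrossingIn_treeBoxes h hnc halt
    have hcard := (hSnc.card_eq_iff h.nonempty (treeBoxes_subset T)).2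
      (mem_span_treeBoxes h hTS hT.connected)
    rw [← Finset.card_image_of_injective _ boxWeight_injective] at hcard
    refine ⟨(treeBoxes μ a b T).image boxWeight, mem_faces_noncrossingComplex.2
      ⟨Finset.card_pos.1 (by omega), _, treeBoxes_subset T, hSnc, by simp⟩, hcard, ?_⟩
    rw [Finset.coe_image]
    exact preimage_acyclicRootPolytope h hTS hT hnc halt Λ hΛ
  · rintro _ ⟨T, hTG, hT, hnc, halt, rfl⟩ _ ⟨T', hTG', hT', hnc', halt', rfl⟩ heq
    simp only at heq
    have hTS := boxGraph_treeBoxes h hG hTG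
    have hTS' := boxGraph_treeBoxes h hG hTG'
    rw [preimage_acyclicRootPolytope h hTS hT hnc halt Λ hΛ,
      preimage_acyclicRootPolytope h hTS' hT' hnc' halt' Λ hΛ] at heq
    have := convexHull_injOn (isNoncrossingIn_treeBoxes h hnc halt) (treeBoxes_subset T)
      (isNoncrossingIn_treeBoxes h hnc' halt') (treeBoxes_subset T') heq
    rw [← hTS, ← hTS', this]
  · rintro _ ⟨s, hs, hcard, rfl⟩
    obtain ⟨-, S, hSμ, hS, hsS⟩ := mem_faces_noncrossingComplex.1 hs
    have hs' : s = S.image boxWeight := by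
      rw [← Finset.coe_inj, hsS, Finset.coe_image]
    rw [hs', Finset.card_image_of_injective _ boxWeight_injective,
      hS.card_eq_iff h.nonempty hSμ] at hcard
    -- A full-dimensional simplex contains all boxes with coinciding labels, so passing to its graph
    -- loses nothing.
    have hdiag : ∀ p ∈ μ, b p.2 = a p.1 → p ∈ S := fun p hp => mem_of_spans h hSμ hS hcard hp
    have hST := treeBoxes_boxGraph h hSμ hdiag
    have htree := isTree_boxGraph h hSμ hS hcard Λ hΛ
    have hnc := isNoncrossing_boxGraph h hSμ hS
    have halt := isAlternating_boxGraph h hSμ hS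
    refine ⟨_, ⟨boxGraph a b S, ?_, htree, hnc, halt, rfl⟩, ?_⟩
    · have key : ∀ u v, u < v → (boxGraph a b S).Adj u v → (dirTransClosure G).Adj u v := by
        intro u v huv hadj
        obtain ⟨p, hp, hpu, hpv⟩ := (boxGraph_adj_iff h hSμ huv).1 hadj
        exact (hG u v huv).2 ⟨p, hSμ hp, hpu, hpv⟩
      intro u v hadj
      rcases lt_or_gt_of_ne hadj.ne with huv | huv
      · exact key u v huv hadj
      · exact (key v u huv hadj.symm).symm
    · simp only
      rw [preimage_acyclicRootPolytope h (by rw [hST]) htree hnc halt Λ hΛ, hST, hsS]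

end Preimage

/-! ### Counting boxes of lower sets -/

section Counting

variable {N : ℕ}

theorem mem_iff_lt_card_of_isLowerSet {T : Finset (Fin N)} (hT : IsLowerSet (T : Set (Fin N)))
    (j : Fin N) : j ∈ T ↔ (j : ℕ) < T.card := by
  constructor
  · intro hj
    have : Finset.Iic j ⊆ T := fun k hk => hT (Finset.mem_Iic.1 hk) hj
    have := Finset.card_le_card this
    rw [Fin.card_Iic] at this
    omega
  · intro hlt
    by_contra hj
    have : T ⊆ Finset.Iio j := fun k hk => Finset.mem_Iio.2 (by
      by_contra! hle
      exact hj (hT hle hk))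
    have := Finset.card_le_card this
    rw [Fin.card_Iio] at this
    omega

variable {S : Finset (Fin N × Fin N)}

theorem rowCount_eq_card (S : Finset (Fin N × Fin N)) (i : Fin N) :
    rowCount S i = (Finset.univ.filter fun j => (i, j) ∈ S).card := by
  rw [rowCount]
  refine Finset.card_bij' (fun p _ => p.2) (fun j _ => (i, j)) ?_ ?_ ?_ ?_
  · rintro ⟨k, j⟩ hp
    simp only [Finset.mem_filter, Finset.mem_univ, true_and] at hp ⊢
    rw [← hp.2]
    exact hp.1
  · intro j hj
    simpa using hj
  · rintro ⟨k, j⟩ hp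
    simp only [Finset.mem_filter] at hp
    rw [hp.2]
  · intro j _
    rfl

theorem colCount_eq_card (S : Finset (Fin N × Fin N)) (j : Fin N) :
    colCount S j = (Finset.univ.filter fun i => (i, j) ∈ S).card := by
  rw [colCount]
  refine Finset.card_bij' (fun p _ => p.1) (fun i _ => (i, j)) ?_ ?_ ?_ ?_
  · rintro ⟨i, k⟩ hp
    simp only [Finset.mem_filter, Finset.mem_univ, true_and] at hp ⊢
    rw [← hp.2]
    exact hp.1
  · intro i hi
    simpa using hi
  · rintro ⟨i, k⟩ hp
    simp only [Finset.mem_filter] at hp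
    rw [hp.2]
  · intro i _
    rfl

theorem mem_iff_lt_rowCount (hS : IsLowerSet (S : Set (Fin N × Fin N))) (i j : Fin N) :
    (i, j) ∈ S ↔ (j : ℕ) < rowCount S i := by
  rw [rowCount_eq_card, ← mem_iff_lt_card_of_isLowerSet]
  · simp
  · intro k l hlk hk
    simp only [Finset.coe_filter, Finset.mem_univ, true_and, Set.mem_ofPred_eq] at hk ⊢
    exact hS (Prod.mk_le_mk.2 ⟨le_rfl, hlk⟩ : (i, l) ≤ (i, k)) hk

theorem mem_iff_lt_colCount (hS : IsLowerSet (S : Set (Fin N × Fin N))) (i j : Fin N) :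
    (i, j) ∈ S ↔ (i : ℕ) < colCount S j := by
  rw [colCount_eq_card, ← mem_iff_lt_card_of_isLowerSet]
  · simp
  · intro k l hlk hk
    simp only [Finset.coe_filter, Finset.mem_univ, true_and, Set.mem_ofPred_eq] at hk ⊢
    exact hS (Prod.mk_le_mk.2 ⟨hlk, le_rfl⟩ : (l, j) ≤ (k, j)) hk

theorem rowCount_anti (hS : IsLowerSet (S : Set (Fin N × Fin N))) {i k : Fin N} (hik : i ≤ k) :
    rowCount S k ≤ rowCount S i := by
  rw [rowCount_eq_card, rowCount_eq_card]
  refine Finset.card_le_card fun j hj => ?_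
  simp only [Finset.mem_filter, Finset.mem_univ, true_and] at hj ⊢
  exact hS (Prod.mk_le_mk.2 ⟨hik, le_rfl⟩ : (i, j) ≤ (k, j)) hj

theorem colCount_anti (hS : IsLowerSet (S : Set (Fin N × Fin N))) {j k : Fin N} (hjk : j ≤ k) :
    colCount S k ≤ colCount S j := by
  rw [colCount_eq_card, colCount_eq_card]
  refine Finset.card_le_card fun i hi => ?_
  simp only [Finset.mem_filter, Finset.mem_univ, true_and] at hi ⊢
  exact hS (Prod.mk_le_mk.2 ⟨le_rfl, hjk⟩ : (i, j) ≤ (i, k)) hi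

end Counting

/-! ### The diagram of `1π'` for dominant `π'` -/

/-- The diagram is a Young diagram placed in the north-west corner and moved by one step to the
south-east. -/
structure IsShiftedShape {N : ℕ} (π : Equiv.Perm (Fin N)) : Prop where
  pos : ∀ p ∈ rotheDiagram π, 0 < (p.1 : ℕ) ∧ 0 < (p.2 : ℕ)
  mem_of_le : ∀ p ∈ rotheDiagram π, ∀ q, q ≤ p → 0 < (q.1 : ℕ) → 0 < (q.2 : ℕ) →
    q ∈ rotheDiagram π

theorem mem_rotheDiagram {N : ℕ} {π : Equiv.Perm (Fin N)} {p : Fin N × Fin N} :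
    p ∈ rotheDiagram π ↔ ∃ i j : Fin N, i < j ∧ π j < π i ∧ p = (π j, i) := by
  simp [rotheDiagram]

theorem oneTimes_zero {n : ℕ} (π' : Equiv.Perm (Fin n)) : oneTimes π' 0 = 0 := by
  simp [oneTimes]

theorem oneTimes_succ {n : ℕ} (π' : Equiv.Perm (Fin n)) (i : Fin n) :
    oneTimes π' i.succ = (π' i).succ := by
  simp [oneTimes, Equiv.Perm.decomposeFin_symm_apply_succ]

theorem mem_rotheDiagram_oneTimes {n : ℕ} {π' : Equiv.Perm (Fin n)}
    {p : Fin (n + 1) × Fin (n + 1)} : p ∈ rotheDiagram (oneTimes π') ↔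
      ∃ q ∈ rotheDiagram π', p = (q.1.succ, q.2.succ) := by
  rw [mem_rotheDiagram]
  constructor
  · rintro ⟨i, j, hij, hlt, rfl⟩
    obtain ⟨j, rfl⟩ := Fin.exists_succ_eq.2 (Fin.ne_zero_of_lt hij)
    have hi : i ≠ 0 := by
      rintro rfl
      rw [oneTimes_zero] at hlt
      exact Fin.not_lt_zero _ hlt
    obtain ⟨i, rfl⟩ := Fin.exists_succ_eq.2 hi
    rw [oneTimes_succ, oneTimes_succ] at hlt
    exact ⟨(π' j, i), mem_rotheDiagram.2 ⟨i, j, Fin.succ_lt_succ_iff.1 hij,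
      Fin.succ_lt_succ_iff.1 hlt, rfl⟩, by rw [oneTimes_succ]⟩
  · rintro ⟨q, hq, rfl⟩
    obtain ⟨i, j, hij, hlt, rfl⟩ := mem_rotheDiagram.1 hq
    exact ⟨i.succ, j.succ, Fin.succ_lt_succ_iff.2 hij, by
      simpa [oneTimes_succ] using hlt, by simp [oneTimes_succ]⟩

theorem isShiftedShape_oneTimes {n : ℕ} {π' : Equiv.Perm (Fin n)} (h : IsDominant π') :
    IsShiftedShape (oneTimes π') := by
  constructor
  · intro p hp
    obtain ⟨q, -, rfl⟩ := mem_rotheDiagram_oneTimes.1 hp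
    simp
  · intro p hp r hr h1 h2
    obtain ⟨q, hq, rfl⟩ := mem_rotheDiagram_oneTimes.1 hp
    obtain ⟨i, j⟩ := r
    obtain ⟨i, rfl⟩ := Fin.exists_succ_eq.2 (Fin.ne_of_val_ne (j := 0) (by simpa using h1.ne'))
    obtain ⟨j, rfl⟩ := Fin.exists_succ_eq.2 (Fin.ne_of_val_ne (j := 0) (by simpa using h2.ne'))
    rw [Prod.mk_le_mk, Fin.succ_le_succ_iff, Fin.succ_le_succ_iff] at hr
    exact mem_rotheDiagram_oneTimes.2 ⟨(i, j), h (Prod.mk_le_mk.2 hr : (i, j) ≤ (q.1, q.2)) hq, rfl⟩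

/-! ### `NW(π)` as a Young diagram, its corners, and the labels of its boundary -/

section Regions

variable {N : ℕ} {π : Equiv.Perm (Fin N)}

theorem mem_nwRegion {p : Fin N × Fin N} : p ∈ nwRegion π ↔ ∃ q ∈ rotheDiagram π, p ≤ q := by
  simp [nwRegion]

theorem isLowerSet_nwRegion : IsLowerSet (nwRegion π : Set (Fin N × Fin N)) := by
  intro p q hqp hp
  obtain ⟨r, hr, hpr⟩ := mem_nwRegion.1 (Finset.mem_coe.1 hp)
  exact Finset.mem_coe.2 (mem_nwRegion.2 ⟨r, hr, hqp.trans hpr⟩)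

theorem mem_nwRegion_of_mem {p : Fin N × Fin N} (hp : p ∈ rotheDiagram π) : p ∈ nwRegion π :=
  mem_nwRegion.2 ⟨p, hp, le_rfl⟩

/-- A box of `NW(π)` strictly beyond a diagram box to the south or east forces its next box in that
direction into the shifted shape. So the corners of the diagram are the maximal boxes of `NW(π)`,
and removing them leaves a lower set. -/
theorem mem_essentialSet_iff (h : IsShiftedShape π) {p : Fin N × Fin N} :
    p ∈ essentialSet π ↔ p ∈ nwRegion π ∧ ∀ q ∈ nwRegion π, p ≤ q → q = p := by
  rw [essentialSet, Finset.mem_filter]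
  constructor
  · rintro ⟨hp, h1, h2⟩
    refine ⟨mem_nwRegion_of_mem hp, fun q hq hpq => ?_⟩
    obtain ⟨r, hr, hqr⟩ := mem_nwRegion.1 hq
    obtain ⟨p1, p2⟩ := h.pos p hp
    have hpr := hpq.trans hqr
    have e1 : r.1 = p.1 := by
      by_contra hne
      have hlt : p.1 < r.1 := lt_of_le_of_ne hpr.1 (Ne.symm hne)
      have hlt' : (p.1 : ℕ) < r.1 := hlt
      have hb : (p.1 : ℕ) + 1 < N := by omega
      exact h1 ⟨p.1 + 1, hb⟩ rfl (h.mem_of_le r hr _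
        ⟨Fin.le_def.2 (by simp; omega), hpr.2⟩ (by simp) p2)
    have e2 : r.2 = p.2 := by
      by_contra hne
      have hlt : p.2 < r.2 := lt_of_le_of_ne hpr.2 (Ne.symm hne)
      have hlt' : (p.2 : ℕ) < r.2 := hlt
      have hb : (p.2 : ℕ) + 1 < N := by omega
      exact h2 ⟨p.2 + 1, hb⟩ rfl (h.mem_of_le r hr _
        ⟨hpr.1, Fin.le_def.2 (by simp; omega)⟩ p1 (by simp))
    exact le_antisymm (hqr.trans (Prod.ext e1 e2).le) hpq
  · rintro ⟨hp, hmax⟩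
    obtain ⟨r, hr, hpr⟩ := mem_nwRegion.1 hp
    have := hmax r (mem_nwRegion_of_mem hr) hpr
    subst this
    refine ⟨hr, fun i hi hmem => ?_, fun j hj hmem => ?_⟩
    · have := hmax _ (mem_nwRegion_of_mem hmem) ⟨Fin.le_def.2 (by simp; omega), le_rfl⟩
      have := congrArg (fun q : Fin N × Fin N => (q.1 : ℕ)) this
      simp at this
      omega
    · have := hmax _ (mem_nwRegion_of_mem hmem) ⟨le_rfl, Fin.le_def.2 (by simp; omega)⟩
      have := congrArg (fun q : Fin N × Fin N => (q.2 : ℕ)) this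
      simp at this
      omega

theorem essentialSet_subset (h : IsShiftedShape π) : essentialSet π ⊆ nwRegion π :=
  fun _ hp => ((mem_essentialSet_iff h).1 hp).1

theorem pos_of_mem_essentialSet (h : IsShiftedShape π) {p : Fin N × Fin N}
    (hp : p ∈ essentialSet π) : 0 < (p.1 : ℕ) ∧ 0 < (p.2 : ℕ) :=
  h.pos p (Finset.mem_filter.1 hp).1

theorem exists_essential_ge (h : IsShiftedShape π) {p : Fin N × Fin N} (hp : p ∈ nwRegion π) :
    ∃ e ∈ essentialSet π, p ≤ e := by
  obtain ⟨e, hpe, he⟩ := (nwRegion π).exists_le_maximal hp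
  exact ⟨e, (mem_essentialSet_iff h).2 ⟨he.1, fun q hq heq => le_antisymm (he.2 hq heq) heq⟩, hpe⟩

theorem mem_regionR {p : Fin N × Fin N} :
    p ∈ regionR π ↔ p ∈ nwRegion π ∧ p ∉ essentialSet π := by
  simp [regionR]

theorem mem_regionR_of_lt (h : IsShiftedShape π) {p q : Fin N × Fin N} (hq : q ∈ nwRegion π)
    (hpq : p < q) : p ∈ regionR π :=
  mem_regionR.2 ⟨isLowerSet_nwRegion hpq.le hq,
    fun hp => hpq.ne' (((mem_essentialSet_iff h).1 hp).2 q hq hpq.le)⟩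

theorem isLowerSet_regionR (h : IsShiftedShape π) :
    IsLowerSet (regionR π : Set (Fin N × Fin N)) := by
  intro p q hqp hp
  rcases hqp.lt_or_eq with hlt | rfl
  · exact mem_regionR_of_lt h (mem_regionR.1 (Finset.mem_coe.1 hp)).1 hlt
  · exact hp

/-- The westernmost column contains no diagram box, hence no corner: removing the corners never
empties a row. The northernmost row does the same for columns. -/
theorem exists_mem_regionR_row (h : IsShiftedShape π) {p : Fin N × Fin N} (hp : p ∈ nwRegion π) :
    ∃ j, (p.1, j) ∈ regionR π := by
  obtain ⟨e, he, hpe⟩ := exists_essential_ge h hp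
  refine ⟨⟨0, by have := p.1.isLt; omega⟩, mem_regionR_of_lt h (essentialSet_subset h he) ?_⟩
  exact Prod.lt_iff.2 (Or.inr ⟨hpe.1, Fin.lt_def.2 (pos_of_mem_essentialSet h he).2⟩)

theorem exists_mem_regionR_col (h : IsShiftedShape π) {p : Fin N × Fin N} (hp : p ∈ nwRegion π) :
    ∃ i, (i, p.2) ∈ regionR π := by
  obtain ⟨e, he, hpe⟩ := exists_essential_ge h hp
  refine ⟨⟨0, by have := p.1.isLt; omega⟩, mem_regionR_of_lt h (essentialSet_subset h he) ?_⟩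
  exact Prod.lt_iff.2 (Or.inl ⟨Fin.lt_def.2 (pos_of_mem_essentialSet h he).1, hpe.2⟩)

/-! ### Positions along the boundary -/

theorem stepPos_inr_lt (h : IsShiftedShape π) {i j : Fin N} (hij : (i, j) ∈ regionR π) :
    stepPos π (Sum.inr j) < stepPos π (Sum.inl i) := by
  have h1 := (mem_iff_lt_rowCount (isLowerSet_regionR h) i j).1 hij
  have h2 := (mem_iff_lt_colCount (isLowerSet_regionR h) i j).1 hij
  simp only [stepPos]
  omega

theorem stepPos_inl_lt_inr (h : IsShiftedShape π) {i j : Fin N} (hij : (i, j) ∉ regionR π) :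
    stepPos π (Sum.inl i) < stepPos π (Sum.inr j) := by
  have h1 := mt (mem_iff_lt_rowCount (isLowerSet_regionR h) i j).2 hij
  have h2 := mt (mem_iff_lt_colCount (isLowerSet_regionR h) i j).2 hij
  simp only [stepPos]
  omega

theorem stepPos_inl_lt (h : IsShiftedShape π) {i k : Fin N} (hik : i < k) :
    stepPos π (Sum.inl k) < stepPos π (Sum.inl i) := by
  have := rowCount_anti (isLowerSet_regionR h) hik.le
  have : (i : ℕ) < k := hik
  simp only [stepPos]
  omega

theorem stepPos_inr_lt_inr (h : IsShiftedShape π) {j k : Fin N} (hjk : j < k) :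
    stepPos π (Sum.inr j) < stepPos π (Sum.inr k) := by
  have := colCount_anti (isLowerSet_regionR h) hjk.le
  have : (j : ℕ) < k := hjk
  simp only [stepPos]
  omega

theorem stepPos_inl_injective (h : IsShiftedShape π) {i k : Fin N}
    (hik : stepPos π (Sum.inl i) = stepPos π (Sum.inl k)) : i = k := by
  rcases lt_trichotomy i k with hlt | heq | hlt
  · exact absurd hik (stepPos_inl_lt h hlt).ne'
  · exact heq
  · exact absurd hik (stepPos_inl_lt h hlt).ne

/-- The west and north neighbours of a corner `(i, j)` lie in `R(π)`, so in `R(π)` row `i` has `j`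
boxes and column `j` has `i` boxes. The two steps are thus consecutive, and column `j` takes the
label of row `i`. -/
theorem stepPos_essential (h : IsShiftedShape π) {i j : Fin N} (hij : (i, j) ∈ essentialSet π) :
    stepPos π (Sum.inl i) + 1 = stepPos π (Sum.inr j) := by
  have hμ := essentialSet_subset h hij
  obtain ⟨hi, hj⟩ : 0 < (i : ℕ) ∧ 0 < (j : ℕ) := pos_of_mem_essentialSet h hij
  have hR : (i, j) ∉ regionR π := fun hmem => (mem_regionR.1 hmem).2 hij
  have h1 := mt (mem_iff_lt_rowCount (isLowerSet_regionR h) i j).2 hR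
  have h2 := mt (mem_iff_lt_colCount (isLowerSet_regionR h) i j).2 hR
  have h3 := (mem_iff_lt_rowCount (isLowerSet_regionR h) i ⟨j - 1, by omega⟩).1
    (mem_regionR_of_lt h hμ (Prod.mk_lt_mk_iff_right.2 (Fin.lt_def.2 (by simp; omega))))
  have h4 := (mem_iff_lt_colCount (isLowerSet_regionR h) ⟨i - 1, by omega⟩ j).1
    (mem_regionR_of_lt h hμ (Prod.mk_lt_mk_iff_left.2 (Fin.lt_def.2 (by simp; omega))))
  simp only at h3 h4
  simp only [stepPos]
  omega

theorem TVertex.lt_of_stepPos_lt {v w : TVertex π} (hvw : stepPos π v.1 < stepPos π w.1) :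
    v < w :=
  show (toLex (stepPos π v.1, toLex v.1) : ℤ ×ₗ (Fin N ⊕ₗ Fin N)) <
    toLex (stepPos π w.1, toLex w.1) from Prod.Lex.toLex_lt_toLex.2 (Or.inl hvw)

/-! ### Labels of rows and columns -/

theorem inl_mem_labelledSteps {i : Fin N} :
    Sum.inl i ∈ labelledSteps π ↔ ∃ j, (i, j) ∈ regionR π := by
  simp [labelledSteps]

theorem inr_mem_labelledSteps {j : Fin N} :
    Sum.inr j ∈ labelledSteps π ↔
      (∃ i, (i, j) ∈ regionR π) ∧ ¬ ∃ i, (i, j) ∈ essentialSet π := by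
  simp [labelledSteps]

/-- The label of a boundary step. -/
noncomputable def stepLabel (π : Equiv.Perm (Fin N)) [Nonempty (TVertex π)]
    (s : Fin N ⊕ Fin N) : TVertex π :=
  Classical.epsilon (HasLabel π s)

theorem hasLabel_inl_iff {i : Fin N} (hi : Sum.inl i ∈ labelledSteps π) {v : TVertex π} :
    HasLabel π (Sum.inl i) v ↔ v.1 = Sum.inl i := by
  simp [HasLabel, hi]

theorem hasLabel_inr_iff (h : IsShiftedShape π) {j : Fin N} (hj : ∃ i, (i, j) ∈ regionR π)
    {v : TVertex π} : HasLabel π (Sum.inr j) v ↔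
      (v.1 = Sum.inr j ∨ ∃ i, (i, j) ∈ essentialSet π ∧ v.1 = Sum.inl i) := by
  rw [HasLabel]
  refine or_congr_right ⟨?_, ?_⟩
  · rintro ⟨hnot, i, hi, hpos⟩
    rw [inr_mem_labelledSteps] at hnot
    push Not at hnot
    obtain ⟨k, hk⟩ := hnot hj
    have := stepPos_essential h hk
    have : i = k := stepPos_inl_injective h (by omega)
    subst this
    exact ⟨i, hk, hi⟩
  · rintro ⟨i, hi, hv⟩
    exact ⟨fun hmem => (inr_mem_labelledSteps.1 hmem).2 ⟨i, hi⟩, i, hv, stepPos_essential h hi⟩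

variable [Nonempty (TVertex π)]

theorem hasLabel_inl_iff_eq (h : IsShiftedShape π) {p : Fin N × Fin N} (hp : p ∈ nwRegion π)
    {v : TVertex π} : HasLabel π (Sum.inl p.1) v ↔ v = stepLabel π (Sum.inl p.1) := by
  have hmem := inl_mem_labelledSteps.2 (exists_mem_regionR_row h hp)
  have hspec : HasLabel π (Sum.inl p.1) (stepLabel π (Sum.inl p.1)) :=
    Classical.epsilon_spec (p := HasLabel π (Sum.inl p.1)) ⟨⟨_, hmem⟩, Or.inl rfl⟩
  constructor
  · intro hv
    exact Subtype.ext (((hasLabel_inl_iff hmem).1 hv).trans ((hasLabel_inl_iff hmem).1 hspec).symm)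
  · rintro rfl
    exact hspec

theorem stepLabel_inl (h : IsShiftedShape π) {p : Fin N × Fin N} (hp : p ∈ nwRegion π) :
    (stepLabel π (Sum.inl p.1)).1 = Sum.inl p.1 :=
  (hasLabel_inl_iff (inl_mem_labelledSteps.2 (exists_mem_regionR_row h hp))).1
    ((hasLabel_inl_iff_eq h hp).2 rfl)

theorem hasLabel_inr_stepLabel (h : IsShiftedShape π) {p : Fin N × Fin N}
    (hp : p ∈ nwRegion π) : HasLabel π (Sum.inr p.2) (stepLabel π (Sum.inr p.2)) := by
  have hex := exists_mem_regionR_col h hp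
  refine Classical.epsilon_spec (p := HasLabel π (Sum.inr p.2)) ?_
  by_cases he : ∃ i, (i, p.2) ∈ essentialSet π
  · obtain ⟨i, hi⟩ := he
    have hmem := inl_mem_labelledSteps.2 (exists_mem_regionR_row h (essentialSet_subset h hi))
    exact ⟨⟨_, hmem⟩, (hasLabel_inr_iff h hex).2 (Or.inr ⟨i, hi, rfl⟩)⟩
  · exact ⟨⟨_, inr_mem_labelledSteps.2 ⟨hex, he⟩⟩, Or.inl rfl⟩

theorem stepLabel_inr_essential (h : IsShiftedShape π) {p : Fin N × Fin N}
    (hp : p ∈ essentialSet π) : stepLabel π (Sum.inr p.2) = stepLabel π (Sum.inl p.1) := by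
  have hμ := essentialSet_subset h hp
  rcases (hasLabel_inr_iff h (exists_mem_regionR_col h hμ)).1 (hasLabel_inr_stepLabel h hμ) with
    h1 | ⟨i, hi, h1⟩
  · have := (stepLabel π (Sum.inr p.2)).2
    rw [h1] at this
    exact absurd ⟨p.1, hp⟩ (inr_mem_labelledSteps.1 this).2
  · have h2 := stepPos_essential h hi
    have h3 := stepPos_essential h (i := p.1) (j := p.2) hp
    have : i = p.1 := stepPos_inl_injective h (by omega)
    subst this
    exact Subtype.ext (h1.trans (stepLabel_inl h hμ).symm)

theorem stepLabel_inr_not_essential (h : IsShiftedShape π) {p : Fin N × Fin N}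
    (hp : p ∈ nwRegion π) (he : ¬ ∃ i, (i, p.2) ∈ essentialSet π) :
    (stepLabel π (Sum.inr p.2)).1 = Sum.inr p.2 := by
  rcases (hasLabel_inr_iff h (exists_mem_regionR_col h hp)).1 (hasLabel_inr_stepLabel h hp) with
    h1 | ⟨i, hi, -⟩
  · exact h1
  · exact absurd ⟨i, hi⟩ he

theorem hasLabel_inr_iff_eq (h : IsShiftedShape π) {p : Fin N × Fin N} (hp : p ∈ nwRegion π)
    {v : TVertex π} : HasLabel π (Sum.inr p.2) v ↔ v = stepLabel π (Sum.inr p.2) := by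
  constructor
  · intro hv
    rcases (hasLabel_inr_iff h (exists_mem_regionR_col h hp)).1 hv with h1 | ⟨i, hi, h1⟩
    · have hmem := v.2
      rw [h1] at hmem
      exact Subtype.ext (h1.trans
        (stepLabel_inr_not_essential h hp (inr_mem_labelledSteps.1 hmem).2).symm)
    · have h2 := stepLabel_inr_essential h hi
      simp only at h2
      rw [h2]
      exact Subtype.ext (h1.trans (stepLabel_inl h (essentialSet_subset h hi)).symm)
  · rintro rfl
    exact hasLabel_inr_stepLabel h hp

/-- The labels of the steps of the boundary record the region `NW(π)`. -/
theorem isLabelling_stepLabel (h : IsShiftedShape π) : IsLabelling (nwRegion π)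
    (fun i => stepLabel π (Sum.inl i)) (fun j => stepLabel π (Sum.inr j)) where
  nonempty := by
    obtain ⟨v⟩ := ‹Nonempty (TVertex π)›
    rcases hv : v.1 with i | j
    · have := v.2
      rw [hv] at this
      obtain ⟨j, hj⟩ := inl_mem_labelledSteps.1 this
      exact ⟨_, (mem_regionR.1 hj).1⟩
    · have := v.2
      rw [hv] at this
      obtain ⟨i, hi⟩ := (inr_mem_labelledSteps.1 this).1
      exact ⟨_, (mem_regionR.1 hi).1⟩
  lower := isLowerSet_nwRegion
  mem_iff p hp q hq := by
    have hq' : q = (q.1, q.2) := rfl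
    constructor
    · intro hmem
      by_cases hE : (p.1, q.2) ∈ essentialSet π
      · exact (stepLabel_inr_essential h hE).le
      have hR := mem_regionR.2 ⟨hmem, hE⟩
      refine (TVertex.lt_of_stepPos_lt ?_).le
      rw [stepLabel_inl h hp]
      by_cases he : ∃ i, (i, q.2) ∈ essentialSet π
      · obtain ⟨i, hi⟩ := he
        have h1 := stepLabel_inr_essential h hi
        simp only at h1
        have h2 := stepLabel_inl h (essentialSet_subset h hi)
        simp only at h2
        rw [h1, h2]
        have := stepPos_essential h hi
        have := stepPos_inr_lt h hR
        omega
      · rw [stepLabel_inr_not_essential h hq he]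
        exact stepPos_inr_lt h hR
    · intro hle
      by_contra hmem
      refine hle.not_gt (TVertex.lt_of_stepPos_lt ?_)
      rw [stepLabel_inl h hp]
      by_cases he : ∃ i, (i, q.2) ∈ essentialSet π
      · obtain ⟨i, hi⟩ := he
        have h1 := stepLabel_inr_essential h hi
        simp only at h1
        have h2 := stepLabel_inl h (essentialSet_subset h hi)
        simp only at h2
        rw [h1, h2]
        refine stepPos_inl_lt h ?_
        by_contra! hle'
        exact hmem (isLowerSet_nwRegion (Prod.mk_le_mk.2 ⟨hle', le_rfl⟩ : (p.1, q.2) ≤ (i, q.2))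
          (essentialSet_subset h hi))
      · rw [stepLabel_inr_not_essential h hq he]
        exact stepPos_inl_lt_inr h fun hR => hmem (mem_regionR.1 hR).1
  row_lt p hp i hi := by
    have hi' : (i, p.2) ∈ nwRegion π :=
      isLowerSet_nwRegion (Prod.mk_le_mk.2 ⟨hi.le, le_rfl⟩ : (i, p.2) ≤ (p.1, p.2)) hp
    apply TVertex.lt_of_stepPos_lt
    have h1 := stepLabel_inl h hi'
    simp only at h1
    rw [h1, stepLabel_inl h hp]
    exact stepPos_inl_lt h hi
  col_lt p hp j hj := by
    have hj' : (p.1, j) ∈ nwRegion π :=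
      isLowerSet_nwRegion (Prod.mk_le_mk.2 ⟨le_rfl, hj.le⟩ : (p.1, j) ≤ (p.1, p.2)) hp
    apply TVertex.lt_of_stepPos_lt
    have hstep := stepPos_inr_lt_inr h hj
    -- The label of a column sits at its east step, or one position earlier if the column contains a
    -- corner.
    have hlow : stepPos π (Sum.inr p.2) - 1 ≤ stepPos π (stepLabel π (Sum.inr p.2)).1 := by
      by_cases he : ∃ i, (i, p.2) ∈ essentialSet π
      · obtain ⟨i, hi⟩ := he
        have h1 := stepLabel_inr_essential h hi
        simp only at h1
        have h2 := stepLabel_inl h (essentialSet_subset h hi)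
        simp only at h2
        rw [h1, h2]
        have := stepPos_essential h hi
        omega
      · rw [stepLabel_inr_not_essential h hp he]
        omega
    by_cases he' : ∃ i, (i, j) ∈ essentialSet π
    · obtain ⟨i, hi⟩ := he'
      have h1 := stepLabel_inr_essential h hi
      simp only at h1
      have h2 := stepLabel_inl h (essentialSet_subset h hi)
      simp only at h2
      rw [h1, h2]
      have := stepPos_essential h hi
      omega
    · have h1 := stepLabel_inr_not_essential h hj' he'
      simp only at h1
      rw [h1]
      -- If only column `p.2` is moved back by one, the bound `hlow` does not suffice. But `(i, j) ∈
      -- R(π)`, so the step of column `j` comes before the north step of the corner's row.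
      by_cases he : ∃ i, (i, p.2) ∈ essentialSet π
      · obtain ⟨i, hi⟩ := he
        have h1 := stepLabel_inr_essential h hi
        simp only at h1
        have h2 := stepLabel_inl h (essentialSet_subset h hi)
        simp only at h2
        rw [h1, h2]
        exact stepPos_inr_lt h (mem_regionR_of_lt h (essentialSet_subset h hi)
          (Prod.mk_lt_mk_iff_right.2 hj))
      · rw [stepLabel_inr_not_essential h hp he]
        exact hstep
  surj v := by
    rcases hv : v.1 with i | j
    · have hmem := v.2
      rw [hv] at hmem
      obtain ⟨j, hj⟩ := inl_mem_labelledSteps.1 hmem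
      exact Or.inl ⟨(i, j), (mem_regionR.1 hj).1,
        Subtype.ext ((stepLabel_inl h (mem_regionR.1 hj).1).trans hv.symm)⟩
    · have hmem := v.2
      rw [hv] at hmem
      obtain ⟨⟨i, hi⟩, he⟩ := inr_mem_labelledSteps.1 hmem
      exact Or.inr ⟨(i, j), (mem_regionR.1 hi).1, Subtype.ext
        ((stepLabel_inr_not_essential h (p := (i, j)) (mem_regionR.1 hi).1 he).trans hv.symm)⟩

end Regions

/-! ### The tree `T(π)` and its transitive closure -/

section Tree

variable {N : ℕ} {π : Equiv.Perm (Fin N)}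

/-- A row of the diagram starts in column `1`, so its number of boxes is the index of its last
column. Hence a box of `R(π)` carries a dot iff no diagram box lies strictly east of it. -/
theorem lt_rowCount_rotheDiagram_iff (h : IsShiftedShape π) (i j : Fin N) :
    (j : ℕ) < rowCount (rotheDiagram π) i ↔ ∃ k, j < k ∧ (i, k) ∈ rotheDiagram π := by
  rw [rowCount_eq_card]
  constructor
  · intro hlt
    by_contra! hno
    have hsub : (Finset.univ.filter fun k => (i, k) ∈ rotheDiagram π) ⊆
        (Finset.Iic j).erase ⟨0, (Nat.zero_le _).trans_lt j.isLt⟩ := by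
      intro k hk
      simp only [Finset.mem_filter, Finset.mem_univ, true_and] at hk
      refine Finset.mem_erase.2 ⟨?_, Finset.mem_Iic.2 ?_⟩
      · rintro rfl
        exact absurd (h.pos _ hk).2 (by simp)
      · by_contra! hjk
        exact hno k hjk hk
    have := Finset.card_le_card hsub
    rw [Finset.card_erase_of_mem (Finset.mem_Iic.2 (Fin.le_def.2 (Nat.zero_le _))),
      Fin.card_Iic] at this
    omega
  · rintro ⟨k, hjk, hk⟩
    have hsub : Finset.Ioc ⟨0, (Nat.zero_le _).trans_lt j.isLt⟩ k ⊆
        (Finset.univ.filter fun k => (i, k) ∈ rotheDiagram π) := by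
      intro l hl
      rw [Finset.mem_Ioc] at hl
      simp only [Finset.mem_filter, Finset.mem_univ, true_and]
      exact h.mem_of_le _ hk _ (Prod.mk_le_mk.2 ⟨le_rfl, hl.2⟩) (h.pos _ hk).1
        (Fin.lt_def.1 hl.1)
    have := Finset.card_le_card hsub
    rw [Fin.card_Ioc] at this
    change (k : ℕ) - 0 ≤ _ at this
    have : (j : ℕ) < k := hjk
    omega

theorem mem_dots_iff {p : Fin N × Fin N} :
    p ∈ dots π ↔ p ∈ regionR π ∧ rowCount (rotheDiagram π) p.1 ≤ p.2 := by
  simp [dots]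

/-- A box receives a dropped dot if all boxes of the region below it carry dots. -/
theorem mem_droppedDots (h : IsShiftedShape π) {i j : Fin N} (hij : (i, j) ∈ regionR π)
    (hbelow : ∀ k, i < k → (k, j) ∈ regionR π → (k, j) ∈ dots π) :
    (i, j) ∈ droppedDots π := by
  rw [droppedDots, Finset.mem_filter]
  refine ⟨hij, Finset.card_lt_card ?_⟩
  have hN : 0 < N := (Nat.zero_le _).trans_lt i.isLt
  -- The top row contains no diagram box, so the top box of the column carries a dot. It is not
  -- below `(i, j)`, which makes the count strict.
  have hzero : ((⟨0, hN⟩ : Fin N), j) ∈ dots π := by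
    refine mem_dots_iff.2 ⟨isLowerSet_regionR h (Prod.mk_le_mk.2 ⟨Nat.zero_le i.val, le_rfl⟩ :
      ((⟨0, hN⟩ : Fin N), j) ≤ (i, j)) hij, ?_⟩
    by_contra! hlt
    obtain ⟨k, -, hk⟩ := (lt_rowCount_rotheDiagram_iff h _ _).1 hlt
    exact absurd (h.pos _ hk).1 (by simp)
  rw [Finset.ssubset_iff_of_subset]
  · refine ⟨(⟨0, hN⟩, j), Finset.mem_filter.2 ⟨hzero, rfl⟩, fun hmem => ?_⟩
    have := (Finset.mem_filter.1 hmem).2.2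
    exact absurd (Fin.lt_def.1 this) (by simp)
  · rintro ⟨k, l⟩ hkl
    simp only [Finset.mem_filter] at hkl ⊢
    obtain ⟨hkl, rfl, hlt⟩ := hkl
    exact ⟨hbelow k hlt hkl, rfl⟩

/-- A row with a box of the region without a dot, all of whose lower neighbours have dots, contains
a box of the essential set to the east of this box. -/
theorem exists_essential_row (h : IsShiftedShape π) {i j : Fin N} (hij : (i, j) ∈ regionR π)
    (hdot : (i, j) ∉ dots π)
    (hbelow : ∀ k, i < k → (k, j) ∈ regionR π → (k, j) ∈ dots π) :
    ∃ l, j < l ∧ (i, l) ∈ essentialSet π := by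
  have hlt : (j : ℕ) < rowCount (rotheDiagram π) i := by
    by_contra! hle
    exact hdot (mem_dots_iff.2 ⟨hij, hle⟩)
  obtain ⟨k, hjk, hk⟩ := (lt_rowCount_rotheDiagram_iff h i j).1 hlt
  obtain ⟨l, hl, hmax⟩ := (Finset.univ.filter fun l => (i, l) ∈ nwRegion π).exists_le_maximal
    (a := k) (by simpa using mem_nwRegion_of_mem hk)
  simp only [Finset.mem_filter, Finset.mem_univ, true_and] at hmax
  have hjl : j < l := hjk.trans_le hl
  refine ⟨l, hjl, (mem_essentialSet_iff h).2 ⟨hmax.1, ?_⟩⟩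
  rintro ⟨i', l'⟩ hq hle
  obtain ⟨hi, hl'⟩ := Prod.mk_le_mk.1 hle
  -- A lower row reaching column `l` would have a diagram box east of `(i', j)`, which would then
  -- carry no dot, against `hbelow`.
  have hi' : i' = i := by
    by_contra hne
    have hii : i < i' := lt_of_le_of_ne hi (Ne.symm hne)
    have hR : (i', j) ∈ regionR π :=
      mem_regionR_of_lt h hq (Prod.mk_lt_mk_iff_right.2 (hjl.trans_le hl'))
    have hd := (mem_dots_iff.1 (hbelow i' hii hR)).2
    refine hd.not_gt ((lt_rowCount_rotheDiagram_iff h i' j).2 ⟨l', hjl.trans_le hl', ?_⟩)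
    obtain ⟨r, hr, hle⟩ := mem_nwRegion.1 hq
    refine h.mem_of_le r hr _ hle ?_ ?_
    · exact (Nat.zero_le _).trans_lt (Fin.lt_def.1 hii)
    · exact (Nat.zero_le _).trans_lt (Fin.lt_def.1 (hjl.trans_le hl'))
  subst hi'
  exact Prod.ext rfl (le_antisymm (hmax.2 hq hl') hl')

theorem stepVec_eq {s : Fin N ⊕ Fin N} {v : TVertex π} (hv : v.1 = s) :
    stepVec π s = Pi.single v 1 := by
  subst hv
  rw [stepVec, dif_pos v.2]
  rfl

variable [Nonempty (TVertex π)]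

theorem exists_box_of_treeT_adj (h : IsShiftedShape π) {u v : TVertex π} (huv : u < v)
    (hadj : (treeT π).Adj u v) : ∃ p ∈ nwRegion π,
      stepLabel π (Sum.inr p.2) = u ∧ stepLabel π (Sum.inl p.1) = v := by
  have key : ∀ u v : TVertex π, (∃ p ∈ droppedDots π, HasLabel π (Sum.inr p.2) u ∧
      HasLabel π (Sum.inl p.1) v) → ∃ p ∈ nwRegion π,
      stepLabel π (Sum.inr p.2) = u ∧ stepLabel π (Sum.inl p.1) = v := by
    rintro u v ⟨p, hp, hu, hv⟩
    have hpμ := (mem_regionR.1 (Finset.mem_filter.1 hp).1).1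
    exact ⟨p, hpμ, ((hasLabel_inr_iff_eq h hpμ).1 hu).symm,
      ((hasLabel_inl_iff_eq h hpμ).1 hv).symm⟩
  rw [treeT, SimpleGraph.fromRel_adj] at hadj
  rcases hadj.2 with hp | hp
  · exact key u v hp
  · obtain ⟨q, hq, rfl, rfl⟩ := key v u hp
    exact absurd ((isLabelling_stepLabel h).le hq) huv.not_ge

theorem stepLabel_lt (h : IsShiftedShape π) {i j : Fin N} (hij : (i, j) ∈ regionR π) :
    stepLabel π (Sum.inr j) < stepLabel π (Sum.inl i) := by
  obtain ⟨hμ, hE⟩ := mem_regionR.1 hij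
  obtain ⟨e, he, hle⟩ := exists_essential_ge h hμ
  have hlt : (i, j) < e := lt_of_le_of_ne hle (by rintro rfl; exact hE he)
  exact (isLabelling_stepLabel h).lt_of_lt (essentialSet_subset h he) hlt

theorem treeT_adj_of_mem_droppedDots (h : IsShiftedShape π) {i j : Fin N}
    (hij : (i, j) ∈ droppedDots π) :
    (treeT π).Adj (stepLabel π (Sum.inr j)) (stepLabel π (Sum.inl i)) := by
  have hR := (Finset.mem_filter.1 hij).1
  have hμ := (mem_regionR.1 hR).1
  rw [treeT, SimpleGraph.fromRel_adj]
  exact ⟨(stepLabel_lt h hR).ne, Or.inl ⟨_, hij, (hasLabel_inr_iff_eq h hμ).2 rfl,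
    (hasLabel_inl_iff_eq h hμ).2 rfl⟩⟩

/-- If all boxes below `(i, j)` carry dots, this box receives a dropped dot and gives an edge.
Otherwise the southernmost dotless box `(k, j)` below it gives an edge to the label of row `k`. That
row has a corner `(k, l)` with `l > j`, so the label is also that of column `l`, and the path
continues from the box `(i, l)` further east. -/
theorem transGen_of_mem_regionR (h : IsShiftedShape π) {i j : Fin N}
    (hij : (i, j) ∈ regionR π) :
    Relation.TransGen (fun u v => u < v ∧ (treeT π).Adj u v)
      (stepLabel π (Sum.inr j)) (stepLabel π (Sum.inl i)) := by
  induction hn : N - (j : ℕ) using Nat.strong_induction_on generalizing j with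
  | _ n ih =>
    subst hn
    have hedge : ∀ k, (k, j) ∈ droppedDots π →
        stepLabel π (Sum.inr j) < stepLabel π (Sum.inl k) ∧
          (treeT π).Adj (stepLabel π (Sum.inr j)) (stepLabel π (Sum.inl k)) :=
      fun k hk => ⟨stepLabel_lt h (Finset.mem_filter.1 hk).1, treeT_adj_of_mem_droppedDots h hk⟩
    by_cases hbelow : ∀ k, i < k → (k, j) ∈ regionR π → (k, j) ∈ dots π
    · exact Relation.TransGen.single (hedge i (mem_droppedDots h hij hbelow))
    · push Not at hbelow
      obtain ⟨k₀, hik₀, hk₀R, hk₀⟩ := hbelow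
      obtain ⟨k, hk₀k, hk⟩ :=
        (Finset.univ.filter fun k => (k, j) ∈ regionR π ∧ (k, j) ∉ dots π).exists_le_maximal
        (a := k₀) (by simpa using ⟨hk₀R, hk₀⟩)
      simp only [Finset.mem_filter, Finset.mem_univ, true_and] at hk
      obtain ⟨⟨hkR, hkd⟩, hmax⟩ := hk
      have hbelow' : ∀ l, k < l → (l, j) ∈ regionR π → (l, j) ∈ dots π := by
        intro l hkl hl
        by_contra hld
        exact hkl.not_ge (hmax ⟨hl, hld⟩ hkl.le)
      obtain ⟨l, hjl, hl⟩ := exists_essential_row h hkR hkd hbelow'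
      have hlab := stepLabel_inr_essential h hl
      simp only at hlab
      have hiR : (i, l) ∈ regionR π := mem_regionR_of_lt h (essentialSet_subset h hl)
        (Prod.mk_lt_mk_iff_left.2 (hik₀.trans_le hk₀k))
      have hjl' : (j : ℕ) < l := hjl
      have := ih (N - (l : ℕ)) (by omega) hiR rfl
      rw [hlab] at this
      exact Relation.TransGen.head (hedge k (mem_droppedDots h hkR hbelow')) this

/-- An increasing path starts at a column label and ends at a larger row label; `mem_iff` then puts
the box of this column and row into `NW(π)`. -/
theorem dirTransClosure_treeT_adj_iff (h : IsShiftedShape π) (u v : TVertex π) (huv : u < v) :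
    (dirTransClosure (treeT π)).Adj u v ↔ ∃ p ∈ nwRegion π,
      stepLabel π (Sum.inr p.2) = u ∧ stepLabel π (Sum.inl p.1) = v := by
  have hlab := isLabelling_stepLabel h
  rw [dirTransClosure, SimpleGraph.fromRel_adj]
  have hlt : ∀ {u v : TVertex π},
      Relation.TransGen (fun u v => u < v ∧ (treeT π).Adj u v) u v → u < v := by
    intro u v huv
    induction huv with
    | single h1 => exact h1.1
    | tail _ h1 ih => exact ih.trans h1.1
  constructor
  · rintro ⟨-, hT | hT⟩
    · clear huv
      induction hT with
      | single h1 => exact exists_box_of_treeT_adj h h1.1 h1.2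
      | tail h0 h1 ih =>
        obtain ⟨p, hp, hpu, -⟩ := ih
        obtain ⟨q, hq, -, hqv⟩ := exists_box_of_treeT_adj h h1.1 h1.2
        refine ⟨(q.1, p.2), (hlab.mem_iff q hq p hp).2 ?_, hpu, hqv⟩
        rw [hpu, hqv]
        exact ((hlt h0).trans h1.1).le
    · exact absurd (hlt hT) huv.not_gt
  · rintro ⟨p, hp, rfl, rfl⟩
    refine ⟨huv.ne, Or.inl (transGen_of_mem_regionR h (mem_regionR.2 ⟨hp, fun hE => ?_⟩))⟩
    exact huv.ne (stepLabel_inr_essential h hE)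

/-! ### The map `L ∘ K` -/

/-- For a corner column `K` replaces `y_j` by the `x_i` of the corner, which has the same label. So
`L ∘ K` sends each row and column variable of `NW(π)` to minus the basis vector of its label. -/
theorem mapL_mapK_boxWeight (h : IsShiftedShape π) {p : Fin N × Fin N} (hp : p ∈ nwRegion π) :
    (mapL π ∘ₗ mapK π) (boxWeight p) =
      rootVec (stepLabel π (Sum.inr p.2)) (stepLabel π (Sum.inl p.1)) := by
  have hKx : ∀ i, mapK π (Pi.single (Sum.inl i) 1) = Pi.single (Sum.inl i) 1 := by
    intro i
    rw [mapK, Fintype.linearCombination_apply_single, one_smul]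
  have hLx : ∀ q ∈ nwRegion π, mapL π (Pi.single (Sum.inl q.1) 1) =
      -Pi.single (stepLabel π (Sum.inl q.1)) 1 := by
    intro q hq
    rw [mapL, Fintype.linearCombination_apply_single, one_smul, ← stepVec_eq (stepLabel_inl h hq)]
  have hy : mapL π (mapK π (Pi.single (Sum.inr p.2) 1)) =
      -Pi.single (stepLabel π (Sum.inr p.2)) 1 := by
    have hK : mapK π (Pi.single (Sum.inr p.2) 1) =
        if h : ∃ i, (i, p.2) ∈ essentialSet π then Pi.single (Sum.inl h.choose) 1
        else Pi.single (Sum.inr p.2) 1 := by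
      rw [mapK, Fintype.linearCombination_apply_single, one_smul]
    rw [hK]
    split_ifs with he
    · have h1 := hLx _ (essentialSet_subset h he.choose_spec)
      have h2 := stepLabel_inr_essential h he.choose_spec
      simp only at h1 h2
      rw [h1, h2]
    · rw [mapL, Fintype.linearCombination_apply_single, one_smul]
      simp only [he, if_false]
      rw [stepVec_eq (stepLabel_inr_not_essential h hp he)]
  rw [LinearMap.comp_apply, boxWeight, map_sub, map_sub, hKx, hLx p hp, hy, rootVec]
  abel

end Tree

/-! ### The moment polytope -/

section Moment

variable {n : ℕ} {π' : Equiv.Perm (Fin n)}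

theorem regionL_eq {N : ℕ} {π : Equiv.Perm (Fin N)} (h : IsShiftedShape π) :
    regionL π = (nwRegion π : Set (Fin N × Fin N)) := by
  have : dominantPiece π = ∅ := by
    ext p
    simp only [dominantPiece, Set.mem_ofPred_eq, Set.mem_empty_iff_false, iff_false]
    rintro ⟨c, hc, hc1, -⟩
    exact absurd (h.pos c hc).1 (by omega)
  rw [regionL, this, Set.sdiff_empty]

theorem transvection_mul_neg {R ι : Type*} [CommRing R] [Fintype ι] [DecidableEq ι] {i j : ι}
    {t : R} (h : i = j → t = 0) :
    Matrix.transvection i j t * Matrix.transvection i j (-t) = 1 := by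
  by_cases hij : i = j
  · simp [h hij]
  · rw [Matrix.transvection_mul_transvection_same _ _ hij, add_neg_cancel, Matrix.transvection_zero]

/-- Since `1π'` fixes the first letter, its matrix has a `1` in the top left box. One row and one
column operation carry this `1` to `(i, j)`, where it is added to an entry `0` or `1`. The
parameters vanish when the index is `0`, since no operation is needed then. -/
theorem exists_borelOrbit_ne_zero (i j : Fin (n + 1)) :
    ∃ M ∈ borelOrbit (oneTimes π'), M i j ≠ 0 := by
  classical
  set t : ℂ := if i = 0 then 0 else 1 with ht
  set s : ℂ := if j = 0 then 0 else 1 with hs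
  have ht0 : i = 0 → t = 0 := fun h => by simp [ht, h]
  have hs0 : (0 : Fin (n + 1)) = j → s = 0 := fun h => by simp [hs, ← h]
  have hX := transvection_mul_neg ht0
  have hY : Matrix.transvection 0 j (-s) * Matrix.transvection 0 j s = 1 := by
    simpa using transvection_mul_neg (t := -s) fun h => by simp [hs0 h]
  refine ⟨_, ⟨Matrix.transvection i 0 t, Matrix.transvection 0 j (-s),
    IsUnit.of_mul_eq_one _ hX, IsUnit.of_mul_eq_one _ hY, ?_, ?_, rfl⟩, ?_⟩
  · intro k l hkl
    have h0 : (0 : Fin (n + 1)) ≠ l := (Fin.pos_of_ne_zero (Fin.ne_zero_of_lt hkl)).ne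
    simp [Matrix.transvection, Matrix.one_apply_ne hkl.ne, Matrix.single, h0]
  · intro k l hkl
    have h0 : (0 : Fin (n + 1)) ≠ k := (Fin.pos_of_ne_zero (Fin.ne_zero_of_lt hkl)).ne
    simp [Matrix.transvection, Matrix.one_apply_ne hkl.ne', Matrix.single, h0]
  · have hcol : ∀ k, permMatrix (oneTimes π') k 0 = if k = 0 then 1 else 0 := by
      intro k
      simp [permMatrix, oneTimes_zero, eq_comm]
    have hrow : ∀ l, permMatrix (oneTimes π') 0 l = if l = 0 then 1 else 0 := by
      intro l
      have : oneTimes π' l = 0 ↔ l = 0 := by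
        rw [← (oneTimes π').injective.eq_iff (a := l) (b := 0), oneTimes_zero]
      simp [permMatrix, this]
    rw [Matrix.inv_eq_right_inv hY]
    have hval : (Matrix.transvection i 0 t * permMatrix (oneTimes π') *
        Matrix.transvection 0 j s) i j = permMatrix (oneTimes π') i j +
          t * permMatrix (oneTimes π') 0 j + (permMatrix (oneTimes π') i 0 +
          t * permMatrix (oneTimes π') 0 0) * s := by
      rw [Matrix.transvection, Matrix.transvection, mul_add, add_mul, mul_one, one_mul]
      simp [Matrix.add_apply]
    rw [hval, hcol, hcol, hrow]
    by_cases hi : i = 0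
    · by_cases hj : j = 0
      · simp [hi, hj, ht, hs, hcol]
      · simp [hi, hj, ht, hs, hrow]
    · by_cases hj : j = 0
      · simp [hi, hj, ht, hs, hcol]
      · simp only [hi, hj, ht, hs, permMatrix, Matrix.of_apply, if_false, if_true]
        split_ifs <;> norm_num

theorem momentPolytopeY_eq (h : IsShiftedShape (oneTimes π')) :
    momentPolytopeY (oneTimes π') = convexHull ℝ
      (boxWeight '' (nwRegion (oneTimes π') : Set (Fin (n + 1) × Fin (n + 1)))) := by
  rw [momentPolytopeY, momentPolytope]
  congr 1
  ext w
  constructor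
  · rintro ⟨p, -, rfl⟩
    exact ⟨p.1, by rw [← regionL_eq h]; exact p.2, rfl⟩
  · rintro ⟨p, hp, rfl⟩
    rw [← regionL_eq h] at hp
    refine ⟨⟨p, hp⟩, ?_, rfl⟩
    obtain ⟨M, hM, hMp⟩ := exists_borelOrbit_ne_zero (π' := π') p.1 p.2
    set z : regionL (oneTimes π') → ℂ := fun q => M q.1.1 q.1.2 with hz
    have hzp : z ⟨p, hp⟩ ≠ 0 := hMp
    have hz0 : z ≠ 0 := fun h0 => hzp (by rw [h0]; rfl)
    refine ⟨Projectivization.mk ℂ z hz0, ⟨z, hz0, ⟨M, fun f hf => hf M hM, rfl⟩, rfl⟩, ?_⟩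
    -- The chosen representative is a nonzero multiple of `z`, so the same coordinates vanish.
    obtain ⟨a, ha⟩ := Projectivization.exists_smul_eq_mk_rep ℂ z hz0
    rw [← ha]
    exact mul_ne_zero a.ne_zero hzp

end Moment

end SchubertRoot

/-! ### The canonical triangulation -/

open SchubertRoot
theorem theorem5p7 (n : ℕ) (π' : Equiv.Perm (Fin n)) (hπ' : IsDominant π') :
    ∃ C : Geometry.SimplicialComplex ℝ (Fin (n + 1) ⊕ Fin (n + 1) → ℝ),
      IsTriangulation C (momentPolytopeY (oneTimes π')) ∧
      Set.BijOn (preimageLK (oneTimes π')) (canonicalTopSimplices (treeT (oneTimes π')))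
        (topSimplices C (momentPolytopeY (oneTimes π'))) := by
  have h := isShiftedShape_oneTimes hπ'
  have hpoly := momentPolytopeY_eq h
  refine ⟨noncrossingComplex (nwRegion (oneTimes π')), ?_, ?_⟩
  · rw [hpoly]
    exact isTriangulation_noncrossingComplex isLowerSet_nwRegion
  -- Without vertices `NW(π)` is empty. Both sides are then empty, since a tree has a vertex and a
  -- face is nonempty.
  · rcases isEmpty_or_nonempty (TVertex (oneTimes π')) with hV | hV
    · have hμ : nwRegion (oneTimes π') = ∅ := by
        rw [Finset.eq_empty_iff_forall_notMem]
        exact fun p hp => hV.false ⟨_, inl_mem_labelledSteps.2 (exists_mem_regionR_row h hp)⟩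
      have h1 : canonicalTopSimplices (treeT (oneTimes π')) = ∅ := by
        rw [Set.eq_empty_iff_forall_notMem]
        rintro _ ⟨T, -, hT, -⟩
        exact hV.false hT.connected.nonempty.some
      have h2 : topSimplices (noncrossingComplex (nwRegion (oneTimes π')))
          (momentPolytopeY (oneTimes π')) = ∅ := by
        rw [Set.eq_empty_iff_forall_notMem]
        rintro _ ⟨s, hs, -⟩
        obtain ⟨hne, S, hS, -, hsS⟩ := mem_faces_noncrossingComplex.1 hs
        rw [hμ, Finset.subset_empty] at hS
        rw [hS, Finset.coe_empty, Set.image_empty, Finset.coe_eq_empty] at hsS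
        exact hne.ne_empty hsS
      rw [h1, h2]
      exact Set.bijOn_empty _
    · have key := bijOn_preimage (isLabelling_stepLabel h) (dirTransClosure_treeT_adj_iff h)
        (mapL (oneTimes π') ∘ₗ mapK (oneTimes π')) fun p hp => mapL_mapK_boxWeight h hp
      rw [← hpoly] at key
      exact key
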